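/- Setting. Let $k$ be a number field, let $X\subseteq\mathbb P^N$ be a nonempty projective variety over $k$ (the zero scheme of a homogeneous prime ideal $I\subset k[x_0,\dots,x_N]$), and let $L=\mathcal O(1)|_X$. Let $d\ge 2$, let $\tilde\varphi:\mathbb P^N\to\mathbb P^N$ be a morphism of degree $d$ over $k$ with $\tilde\varphi(X)\subseteq X$, put $\varphi=\tilde\varphi|_X$, and fix a homogeneous lift $F=(F_0,\dots,F_N)$ of $\tilde\varphi$: forms of degree $d$ over $k$ whose only common zero over $\bar k$ is the origin. For a number field $K\supseteq k$ regard all of these over $K$ (so $X$ stands for $X_K$). For a place $v$ of $K$ and $0\neq\tilde x\in\mathbb C_v^{N+1}$ let $$G_v(\tilde x)=\lim_{j\to\infty}\frac{\log\|F^j(\tilde x)\|_v}{d^j},\qquad \|\cdot\|_v\text{ the maximum norm.}$$ Let $L_n=L^{\otimes d^n}$. For a section $s$ of $L_n$ and $x\in X(\mathbb C_v)$ with lift $\tilde x$ put $|s(x)|_v=|s(\tilde x)|_v\,e^{-d^nG_v(\tilde x)}$ (independent of the lift), and $|s|_{v,\sup}=\sup_{x\in X(\mathbb C_v)}|s(x)|_v$.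 Let - $V_n=H^0(X,L_n)\otimes_{\mathbb Q}\mathbb R$, with the norm $|s|_{\sup}=\max_\sigma|s_\sigma|_{\sup}$, where $\sigma$ runs over the embeddings $K\hookrightarrow\mathbb C$ and $s_\sigma\in H^0(X_\sigma(\mathbb C),L_n)$ is the $\sigma$-component of $s$; - $C_{n,\sup}=\{s\in V_n:|s|_{\sup}\le 1\}$; - $M_n=\{s\in H^0(X,L_n):|s|_{v,\sup}\le 1\text{ for all non-archimedean }v\}$. For a Haar measure on $V_n$ let $\operatorname{vol}(M_n)$ be the volume of a fundamental domain of $M_n$; let $h$ be the absolute logarithmic Weil height. **Theorem.** There is a constant $c>0$, depending only on the data $(k,X,\varphi)$ with the chosen embedding and lift, such that the following hold. 1. For $K=k$, all $n>0$, and all $\alpha\in K$ with $K=\mathbb Q(\alpha)$: $$\frac1{\dim_{\mathbb R} V_n}\bigl(\log\operatorname{vol}(C_{n,\sup})-\log\operatorname{vol}(M_n)\bigr)\ \ge\ -c\,\bigl(d^{n/2}+[K:\mathbb Q]^2h(\alpha)\bigr).\qquad(*)$$ 2. The constant $c$ does not depend on the field over which the data are considered: for every $D$ there is $n_0$, depending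 only on the same data and on $D$, such that $(*)$ holds for every number field $K\supseteq k$ with $[K:\mathbb Q]=D$, all $n\ge n_0$, and all $\alpha\in K$ with $K=\mathbb Q(\alpha)$. In each case $V_n$ is finite-dimensional, $M_n$ is a lattice of full rank in $V_n$, $C_{n,\sup}$ has finite positive volume, and $(*)$ holds for every choice of the Haar measure on $V_n$. -/

import Mathlib

open scoped TensorProduct

universe u

noncomputable section

namespace PolarizedVolume

open MvPolynomial MeasureTheory Filter Topology

/-! ### Global sections of `O_X(m)` for a closed subscheme `X` of projective space -/

section Sections

variable {K : Type u} [Field K] {N : ℕ}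

/-- The homogeneous coordinate ring `K[x_0, …, x_N] / I` of the closed subscheme `X = V₊(I)` of
`ℙ^N` over `K`. -/
abbrev CoordRing (I : Ideal (MvPolynomial (Fin (N + 1)) K)) : Type u :=
  MvPolynomial (Fin (N + 1)) K ⧸ I

/-- The class of the coordinate `x_i` in the homogeneous coordinate ring. -/
def coordElt (I : Ideal (MvPolynomial (Fin (N + 1)) K)) (i : Fin (N + 1)) : CoordRing I :=
  Ideal.Quotient.mk I (X i)

/-- The coordinate ring of the part of the affine cone over `X` where `x_i ≠ 0`. -/
abbrev Chart (I : Ideal (MvPolynomial (Fin (N + 1)) K)) (i : Fin (N + 1)) : Type u :=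
  Localization.Away (coordElt I i)

/-- The coordinate ring of the part of the affine cone over `X` where `x_i x_j ≠ 0`. -/
abbrev Overlap (I : Ideal (MvPolynomial (Fin (N + 1)) K)) (i j : Fin (N + 1)) : Type u :=
  Localization.Away (coordElt I i * coordElt I j)

/-- Restriction from the `i`-th chart to the overlap of the charts `i` and `j`. -/
def resLeft (I : Ideal (MvPolynomial (Fin (N + 1)) K)) (i j : Fin (N + 1)) :
    Chart I i →+* Overlap I i j :=
  IsLocalization.Away.awayToAwayRight (coordElt I i) (coordElt I j)

/-- Restriction from the `j`-th chart to the overlap of the charts `i` and `j`. -/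
def resRight (I : Ideal (MvPolynomial (Fin (N + 1)) K)) (i j : Fin (N + 1)) :
    Chart I j →+* Overlap I i j :=
  IsLocalization.Away.awayToAwayLeft (coordElt I j) (coordElt I i)

/-- `t` is a section of `O_X(m)` over the chart `x_i ≠ 0`: a fraction `p / x_i ^ r` with `p`
homogeneous of degree `m + r`. -/
def IsChartSection (I : Ideal (MvPolynomial (Fin (N + 1)) K)) (m : ℕ) (i : Fin (N + 1))
    (t : Chart I i) : Prop :=
  ∃ (r : ℕ) (p : MvPolynomial (Fin (N + 1)) K), p.IsHomogeneous (m + r) ∧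
    t * algebraMap (CoordRing I) (Chart I i) (coordElt I i) ^ r =
      algebraMap (CoordRing I) (Chart I i) (Ideal.Quotient.mk I p)

theorem smul_chart (I : Ideal (MvPolynomial (Fin (N + 1)) K)) (i : Fin (N + 1)) (c : K)
    (t : Chart I i) :
    c • t = algebraMap (CoordRing I) (Chart I i) (Ideal.Quotient.mk I (C c)) * t := by
  rw [Algebra.smul_def, IsScalarTower.algebraMap_apply K (CoordRing I) (Chart I i)]
  rfl

/-- `H⁰(X, O_X(m))` for `X = V₊(I) ⊆ ℙ^N`, as the zeroth Čech cohomology of `O_X(m)` for the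
standard affine cover: families of sections over the charts that agree on the overlaps. -/
def GlobalSections (I : Ideal (MvPolynomial (Fin (N + 1)) K)) (m : ℕ) :
    Submodule K (∀ i, Chart I i) where
  carrier := {s | (∀ i, IsChartSection I m i (s i)) ∧
    ∀ i j, resLeft I i j (s i) = resRight I i j (s j)}
  add_mem' := by
    rintro s t ⟨hs, hs'⟩ ⟨ht, ht'⟩
    refine ⟨fun i => ?_, fun i j => ?_⟩
    · obtain ⟨r, p, hp, hpe⟩ := hs i
      obtain ⟨r', q, hq, hqe⟩ := ht i
      refine ⟨r + r', p * X i ^ r' + q * X i ^ r, ?_, ?_⟩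
      · refine IsHomogeneous.add ?_ ?_
        · have := hp.mul ((isHomogeneous_X K i).pow r')
          convert this using 1
          ring
        · have := hq.mul ((isHomogeneous_X K i).pow r)
          convert this using 1
          ring
      · simp only [Pi.add_apply, map_add, map_mul, map_pow, ← hpe, ← hqe, coordElt]
        ring
    · simp only [Pi.add_apply, map_add, hs' i j, ht' i j]
  zero_mem' := ⟨fun i => ⟨0, 0, isHomogeneous_zero _ _ _, by simp⟩, fun i j => by simp⟩
  smul_mem' := by
    rintro c s ⟨hs, hs'⟩
    refine ⟨fun i => ?_, fun i j => ?_⟩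
    · obtain ⟨r, p, hp, hpe⟩ := hs i
      refine ⟨r, C c * p, ?_, ?_⟩
      · simpa using (isHomogeneous_C (Fin (N + 1)) c).mul hp
      · rw [Pi.smul_apply, smul_chart, mul_assoc, hpe, ← map_mul, ← map_mul]
    · simp only [Pi.smul_apply, smul_chart, map_mul, hs' i j]
      congr 1
      simp only [resLeft, resRight, IsLocalization.Away.awayToAwayLeft_eq,
        IsLocalization.Away.awayToAwayRight_eq]

/-! ### Values of sections at geometric points -/

/-- The points different from the origin of the affine cone over `X`, with coordinates in a field
`C` that contains `K` through `σ`; that is, the lifts `x̃` of the points `x ∈ X(C)`. -/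
structure ConePoint {C : Type*} [Field C] (I : Ideal (MvPolynomial (Fin (N + 1)) K))
    (σ : K →+* C) where
  coords : Fin (N + 1) → C
  ne_zero : coords ≠ 0
  vanish : ∀ p ∈ I, eval₂ σ coords p = 0

variable {C : Type*} [Field C] {I : Ideal (MvPolynomial (Fin (N + 1)) K)} {σ : K →+* C}

/-- Evaluation of elements of the homogeneous coordinate ring at a point of the cone. -/
def ConePoint.eval (x : ConePoint I σ) : CoordRing I →+* C :=
  Ideal.Quotient.lift I (eval₂Hom σ x.coords) fun p hp => (coe_eval₂Hom σ x.coords ▸ x.vanish p hp)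

theorem ConePoint.eval_coordElt (x : ConePoint I σ) (i : Fin (N + 1)) :
    x.eval (coordElt I i) = x.coords i := by
  rw [ConePoint.eval, coordElt, Ideal.Quotient.lift_mk, coe_eval₂Hom, eval₂_X]

/-- Evaluation of elements of the `i`-th chart at a point of the cone with `x_i ≠ 0`. -/
def ConePoint.evalChart (x : ConePoint I σ) (i : Fin (N + 1)) (hi : x.coords i ≠ 0) :
    Chart I i →+* C :=
  Localization.awayLift x.eval (coordElt I i) (by rw [x.eval_coordElt]; exact hi.isUnit)

theorem ConePoint.exists_coord_ne_zero (x : ConePoint I σ) : ∃ i, x.coords i ≠ 0 :=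
  Function.ne_iff.mp x.ne_zero

/-- The value `s(x̃)` of a section `s` of `O_X(m)` at a point `x̃` of the cone, computed in some
chart that contains `x̃`; by `ConePoint.value_eq` the choice of the chart does not matter. -/
def ConePoint.value (x : ConePoint I σ) (m : ℕ) : GlobalSections I m →+ C where
  toFun s := x.evalChart _ x.exists_coord_ne_zero.choose_spec (s.1 _)
  map_zero' := by simp
  map_add' s t := by simp

theorem ConePoint.value_eq (x : ConePoint I σ) (m : ℕ) (s : GlobalSections I m)
    (i : Fin (N + 1)) (hi : x.coords i ≠ 0) : x.value m s = x.evalChart i hi (s.1 i) := by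
  have key : ∀ (i j : Fin (N + 1)) (hi : x.coords i ≠ 0) (hj : x.coords j ≠ 0),
      x.evalChart i hi (s.1 i) = x.evalChart j hj (s.1 j) := by
    intro i j hi hj
    have hu : IsUnit (x.eval (coordElt I i * coordElt I j)) := by
      rw [map_mul, x.eval_coordElt, x.eval_coordElt]
      exact (mul_ne_zero hi hj).isUnit
    let e : Overlap I i j →+* C := Localization.awayLift x.eval _ hu
    have h1 : e.comp (resLeft I i j) = x.evalChart i hi := by
      apply IsLocalization.ringHom_ext (Submonoid.powers (coordElt I i))
      refine RingHom.ext fun a => ?_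
      simp only [RingHom.comp_apply, e, resLeft, IsLocalization.Away.awayToAwayRight_eq,
        ConePoint.evalChart, Localization.awayLift, IsLocalization.Away.lift_eq]
    have h2 : e.comp (resRight I i j) = x.evalChart j hj := by
      apply IsLocalization.ringHom_ext (Submonoid.powers (coordElt I j))
      refine RingHom.ext fun a => ?_
      simp only [RingHom.comp_apply, e, resRight, IsLocalization.Away.awayToAwayLeft_eq,
        ConePoint.evalChart, Localization.awayLift, IsLocalization.Away.lift_eq]
    rw [← h1, ← h2, RingHom.comp_apply, RingHom.comp_apply, s.2.2 i j]
  exact key _ _ x.exists_coord_ne_zero.choose_spec hi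

end Sections

/-! ### The canonical metric -/

section Metric

variable {K : Type u} [Field K] {N : ℕ} {C : Type*} [NormedField C]

/-- The self-map of affine space over `C` given by the homogeneous lift `F`. -/
def liftMap (F : Fin (N + 1) → MvPolynomial (Fin (N + 1)) K) (σ : K →+* C)
    (x : Fin (N + 1) → C) : Fin (N + 1) → C :=
  fun i => eval₂ σ x (F i)

/-- The homogeneous Green's function `G_v(x) = lim log ‖F^n(x)‖ / d ^ n`, where `‖·‖` is the
maximum norm of the coordinates and the absolute value is that of `C`. -/
def green (F : Fin (N + 1) → MvPolynomial (Fin (N + 1)) K) (d : ℕ) (σ : K →+* C)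
    (x : Fin (N + 1) → C) : ℝ :=
  limUnder atTop fun n : ℕ => Real.log ‖(liftMap F σ)^[n] x‖ / (d : ℝ) ^ n

end Metric

/-! ### The lattice, the unit ball and their volumes -/

section Volumes

variable {K : Type u} [Field K] [NumberField K] {N : ℕ}

/-- `M_n`: the sections `s` of `O_X(d ^ n)` with `|s|_{v,sup} ≤ 1` for every non-archimedean place
`v`. The pairs of `v` and an embedding of `K` in `ℂ_v` are the embeddings of `K` in the fields
`ℂ_[p]`. -/
def integralSections (I : Ideal (MvPolynomial (Fin (N + 1)) K))
    (F : Fin (N + 1) → MvPolynomial (Fin (N + 1)) K) (d n : ℕ) :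
    AddSubgroup (GlobalSections I (d ^ n)) where
  carrier := {s | ∀ (p : ℕ) [Fact p.Prime] (σ : K →+* ℂ_[p]) (x : ConePoint I σ),
    ‖x.value (d ^ n) s‖ * Real.exp (-((d : ℝ) ^ n * green F d σ x.coords)) ≤ 1}
  zero_mem' := by
    intro p _ σ x
    simp
  add_mem' := by
    intro s t hs ht p _ σ x
    rw [map_add]
    refine (mul_le_mul_of_nonneg_right (PadicComplex.isNonarchimedean p _ _)
      (Real.exp_pos _).le).trans ?_
    rw [max_mul_of_nonneg _ _ (Real.exp_pos _).le]
    exact max_le (hs p σ x) (ht p σ x)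
  neg_mem' := by
    intro s hs p _ σ x
    rw [map_neg, norm_neg]
    exact hs p σ x

/-- `V_n = H⁰(X, O_X(d ^ n)) ⊗_ℚ ℝ`. -/
abbrev RealSections (I : Ideal (MvPolynomial (Fin (N + 1)) K)) (d n : ℕ) : Type u :=
  ℝ ⊗[ℚ] GlobalSections I (d ^ n)

/-- For an embedding `σ` of `K` in `ℂ`, the value at a complex point of the cone of the component
of `s ∈ V_n` in `H⁰(X_σ, O(d ^ n))`. It is the `ℝ`-linear extension of the value on
`H⁰(X, O(d ^ n))`. -/
def realValue {I : Ideal (MvPolynomial (Fin (N + 1)) K)} {σ : K →+* ℂ} (x : ConePoint I σ)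
    (d n : ℕ) : RealSections I d n →ₗ[ℝ] ℂ :=
  LinearMap.liftBaseChange ℝ (x.value (d ^ n)).toRatLinearMap

/-- The unit ball `C_n` of `V_n` for the supremum norm: `|s(x)|_σ ≤ 1` at all complex points `x` of
`X` and for all embeddings `σ` of `K` in `ℂ`. -/
def supBall (I : Ideal (MvPolynomial (Fin (N + 1)) K))
    (F : Fin (N + 1) → MvPolynomial (Fin (N + 1)) K) (d n : ℕ) : Set (RealSections I d n) :=
  {s | ∀ (σ : K →+* ℂ) (x : ConePoint I σ),
    ‖realValue x d n s‖ * Real.exp (-((d : ℝ) ^ n * green F d σ x.coords)) ≤ 1}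

/-- The lattice `M_n` in `V_n`, read in the linear coordinates `e` of `V_n`. -/
def coordLattice (I : Ideal (MvPolynomial (Fin (N + 1)) K))
    (F : Fin (N + 1) → MvPolynomial (Fin (N + 1)) K) (d n : ℕ) {r : ℕ}
    (e : RealSections I d n ≃ₗ[ℝ] (Fin r → ℝ)) : Submodule ℤ (Fin r → ℝ) :=
  ((integralSections I F d n).map
    (e.toLinearMap.toAddMonoidHom.comp
      (TensorProduct.mk ℚ ℝ (GlobalSections I (d ^ n)) 1).toAddMonoidHom)).toIntSubmodule

/-- The unit ball `C_n` in `V_n`, read in the linear coordinates `e` of `V_n`. -/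
def coordBall (I : Ideal (MvPolynomial (Fin (N + 1)) K))
    (F : Fin (N + 1) → MvPolynomial (Fin (N + 1)) K) (d n : ℕ) {r : ℕ}
    (e : RealSections I d n ≃ₗ[ℝ] (Fin r → ℝ)) : Set (Fin r → ℝ) :=
  e '' supBall I F d n

/-- The bound for `(log vol C_n - log vol M_n) / dim V_n` with constant `c`, together with
the facts that give it a meaning: `V_n` is finite-dimensional and, in all linear coordinates,
`M_n` is a lattice of full rank and `C_n` has a finite positive volume. The Haar measures on `V_n`
are the transports of Lebesgue measure through the coordinates `e`. Here `h(α)` is the absolute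
logarithmic Weil height. -/
def VolumeBound (I : Ideal (MvPolynomial (Fin (N + 1)) K))
    (F : Fin (N + 1) → MvPolynomial (Fin (N + 1)) K) (d n : ℕ) (α : K) (c : ℝ) : Prop :=
  Module.Finite ℝ (RealSections I d n) ∧
  ∀ e : RealSections I d n ≃ₗ[ℝ] (Fin (Module.finrank ℝ (RealSections I d n)) → ℝ),
    DiscreteTopology (coordLattice I F d n e) ∧
    Submodule.span ℝ (SetLike.coe (coordLattice I F d n e)) = ⊤ ∧
    volume (coordBall I F d n e) ≠ 0 ∧
    volume (coordBall I F d n e) ≠ ⊤ ∧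
    -c * ((d : ℝ) ^ ((n : ℝ) / 2) +
        (Module.finrank ℚ K : ℝ) ^ 2 * (Height.logHeight₁ α / Module.finrank ℚ K)) ≤
      1 / (Module.finrank ℝ (RealSections I d n) : ℝ) *
        (Real.log (volume (coordBall I F d n e)).toReal -
          Real.log (ZLattice.covolume (coordLattice I F d n e)))

end Volumes

end PolarizedVolume

end

/-!
The bound needs no geometry of numbers: it suffices to find sections that are small in all
absolute values at once. Suppose that `b_1, …, b_r` is a `K`-basis of `H⁰(X, O(d ^ n))` and
`w_1, …, w_D` a `ℚ`-basis of `K` such that all `w_j b_i` have norm at most one at the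
non-archimedean places and at most `T` at the archimedean ones. Then the `w_j b_i` form a real
basis of `V_n` inside `M_n`, and `C_n` contains the box of half-width `ρ = (D r T)⁻¹` in this basis.
Comparing `C_n` with the box and `M_n` with the lattice spanned by the basis gives
`log vol C_n - log vol M_n ≥ dim V_n * log (2 ρ)` (`volumeBound_of_basis`). So `log T`, `log r` and
`log D` have to be `O(d ^ (n / 2))`, up to the height term; they will be `O(n)`.

*The basis of `K`.* The powers of `α`, times a power of an integer `a ≤ H(α)` with `a α` integral,
are integral and of size at most `exp (2 D h)`, where `h` is the height of `α` relative to `K`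
(`exists_integral_basis_norm_le`). Since `h` is `D` times the absolute height, this is the height
term of the bound.

*The basis of sections.* By the Nullstellensatz `‖F(x)‖` and `‖x‖ ^ d` are comparable, with
constants `A` at the archimedean places and `|B|⁻¹`, for an integer `B`, at the `p`-adic ones
(`exists_uniform_normGrowth`); the forms of degree `t` lie in the ideal `(F_0, …, F_N)` once `t` is
large. Hence every form of degree `m ≤ d ^ n` is a combination of products of monomials of bounded
degree in the iterates `F^j`, `j ≤ n`. As `G(F(x)) = d G(x)`, such a product has canonical norm
`exp (O(n))`: only `O(n)` factors are used, and each contributes a bounded amount. This is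
`exists_mem_span_smallForms`. A multiple by `B ^ O(n)` is integral at all finite places. These forms
have coefficients in `k`, so that the constants do not depend on `K`.

In large degree every section over `X` is given by a form (`exists_forall_fraction_eq_form`: the
sections of nonnegative degree are integral over the coordinate ring, whose integral closure is
finite). This descends along `K / k` (`FormsInDegree.map`), which settles all `n ≥ n₀`
(`volumeBound_of_le`). For `K = k` the finitely many remaining degrees are treated with an arbitrary
basis and a constant that depends on the degree (`exists_volumeBound`).

That `M_n` is discrete and `C_n` bounded follows by interpolation: forms over `k` that are linearly
independent modulo `I` have an invertible matrix of values at suitable algebraic points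
(`exists_points_det_ne_zero`), so that the coefficients of a section are bounded by its values.
-/

namespace PolarizedVolume

open MvPolynomial MeasureTheory Filter Topology

/-! ### The homogeneous Green's function -/

section Green

variable {K : Type u} [Field K] {N : ℕ} {C : Type*} [NormedField C]

/-- The homogeneous lift `F` of degree `d` changes the maximum norm over `C` like a `d`-th power, up
to the factor `H` in both directions. This is where the absence of nontrivial common zeros of `F`
enters the estimates. -/
structure NormGrowth (F : Fin (N + 1) → MvPolynomial (Fin (N + 1)) K) (d : ℕ) (σ : K →+* C)
    (H : ℝ) : Prop where
  one_le : 1 ≤ H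
  lower : ∀ x : Fin (N + 1) → C, ‖x‖ ^ d ≤ H * ‖liftMap F σ x‖
  upper : ∀ x : Fin (N + 1) → C, ‖liftMap F σ x‖ ≤ H * ‖x‖ ^ d

variable {F : Fin (N + 1) → MvPolynomial (Fin (N + 1)) K} {d : ℕ} {σ : K →+* C} {H : ℝ}

theorem NormGrowth.liftMap_ne_zero (h : NormGrowth F d σ H) {x : Fin (N + 1) → C} (hx : x ≠ 0) :
    liftMap F σ x ≠ 0 := by
  intro h0
  have := h.lower x
  rw [h0, norm_zero, mul_zero] at this
  exact absurd this (not_le.mpr (pow_pos (norm_pos_iff.mpr hx) d))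

theorem NormGrowth.iterate_ne_zero (h : NormGrowth F d σ H) {x : Fin (N + 1) → C} (hx : x ≠ 0)
    (n : ℕ) : (liftMap F σ)^[n] x ≠ 0 := by
  induction n with
  | zero => exact hx
  | succ n ih => rw [Function.iterate_succ_apply']; exact h.liftMap_ne_zero ih

theorem NormGrowth.abs_log_sub_le (h : NormGrowth F d σ H) {x : Fin (N + 1) → C} (hx : x ≠ 0) :
    |Real.log ‖liftMap F σ x‖ - d * Real.log ‖x‖| ≤ Real.log H := by
  have hx' := norm_pos_iff.mpr hx
  have hF := norm_pos_iff.mpr (h.liftMap_ne_zero hx)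
  have hH : 0 < H := zero_lt_one.trans_le h.one_le
  have h1 := Real.log_le_log (pow_pos hx' d) (h.lower x)
  have h2 := Real.log_le_log hF (h.upper x)
  rw [Real.log_mul hH.ne' hF.ne', Real.log_pow] at h1
  rw [Real.log_mul hH.ne' (pow_pos hx' d).ne', Real.log_pow] at h2
  rw [abs_le]
  constructor <;> linarith

theorem NormGrowth.dist_le (h : NormGrowth F d σ H) (hd : 2 ≤ d) {x : Fin (N + 1) → C}
    (hx : x ≠ 0) (n : ℕ) :
    dist (Real.log ‖(liftMap F σ)^[n] x‖ / (d : ℝ) ^ n)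
      (Real.log ‖(liftMap F σ)^[n + 1] x‖ / (d : ℝ) ^ (n + 1)) ≤ Real.log H / 2 / 2 ^ n := by
  have hd' : (2 : ℝ) ≤ d := by exact_mod_cast hd
  have h1 := h.abs_log_sub_le (h.iterate_ne_zero hx n)
  have hlog : 0 ≤ Real.log H := Real.log_nonneg h.one_le
  rw [← Function.iterate_succ_apply' (liftMap F σ)] at h1
  have hpos : (0 : ℝ) < (d : ℝ) ^ (n + 1) := by positivity
  have e : Real.log ‖(liftMap F σ)^[n] x‖ / (d : ℝ) ^ n -
      Real.log ‖(liftMap F σ)^[n + 1] x‖ / (d : ℝ) ^ (n + 1) =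
      -(Real.log ‖(liftMap F σ)^[n + 1] x‖ - d * Real.log ‖(liftMap F σ)^[n] x‖) /
        (d : ℝ) ^ (n + 1) := by
    field_simp
    ring
  rw [Real.dist_eq, e, abs_div, abs_neg, abs_of_pos hpos, div_div, ← pow_succ']
  gcongr

theorem NormGrowth.tendsto_green (h : NormGrowth F d σ H) (hd : 2 ≤ d) {x : Fin (N + 1) → C}
    (hx : x ≠ 0) :
    Tendsto (fun n : ℕ => Real.log ‖(liftMap F σ)^[n] x‖ / (d : ℝ) ^ n) atTop
      (𝓝 (green F d σ x)) :=
  (cauchySeq_of_le_geometric_two (h.dist_le hd hx)).tendsto_limUnder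

theorem NormGrowth.abs_green_sub_le (h : NormGrowth F d σ H) (hd : 2 ≤ d)
    {x : Fin (N + 1) → C} (hx : x ≠ 0) :
    |Real.log ‖x‖ - green F d σ x| ≤ Real.log H := by
  have := dist_le_of_le_geometric_two_of_tendsto₀ (h.dist_le hd hx) (h.tendsto_green hd hx)
  simpa [Real.dist_eq] using this

theorem NormGrowth.green_liftMap (h : NormGrowth F d σ H) (hd : 2 ≤ d)
    {x : Fin (N + 1) → C} (hx : x ≠ 0) :
    green F d σ (liftMap F σ x) = d * green F d σ x := by
  have hd0 : (d : ℝ) ≠ 0 := by positivity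
  refine tendsto_nhds_unique (h.tendsto_green hd (h.liftMap_ne_zero hx)) ?_
  have := ((tendsto_add_atTop_iff_nat 1).mpr (h.tendsto_green hd hx)).const_mul (d : ℝ)
  refine this.congr fun n => ?_
  rw [Function.iterate_succ_apply, pow_succ]
  field_simp

theorem NormGrowth.norm_le (h : NormGrowth F d σ H) (hd : 2 ≤ d)
    {x : Fin (N + 1) → C} (hx : x ≠ 0) : ‖x‖ ≤ H * Real.exp (green F d σ x) := by
  have hH : 0 < H := zero_lt_one.trans_le h.one_le
  have := (abs_le.mp (h.abs_green_sub_le hd hx)).2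
  rw [← Real.exp_log (norm_pos_iff.mpr hx), ← Real.exp_log hH, ← Real.exp_add]
  exact Real.exp_le_exp.mpr (by simpa using (by linarith : Real.log ‖x‖ ≤ _))

theorem NormGrowth.exp_green_le (h : NormGrowth F d σ H) (hd : 2 ≤ d)
    {x : Fin (N + 1) → C} (hx : x ≠ 0) : Real.exp (green F d σ x) ≤ H * ‖x‖ := by
  have hH : 0 < H := zero_lt_one.trans_le h.one_le
  have := (abs_le.mp (h.abs_green_sub_le hd hx)).1
  rw [← Real.exp_log (norm_pos_iff.mpr hx), ← Real.exp_log hH, ← Real.exp_add]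
  exact Real.exp_le_exp.mpr (by simpa using (by linarith : green F d σ x ≤ _))

end Green

section BaseChange

variable {k : Type u} [Field k] {K : Type u} [Field K] [Algebra k K] {N : ℕ} {C : Type*}
  [NormedField C]

theorem green_map (F : Fin (N + 1) → MvPolynomial (Fin (N + 1)) k) (d : ℕ) (σ : K →+* C)
    (x : Fin (N + 1) → C) :
    green (fun i => MvPolynomial.map (algebraMap k K) (F i)) d σ x =
      green F d (σ.comp (algebraMap k K)) x := by
  have : liftMap (fun i => MvPolynomial.map (algebraMap k K) (F i)) σ =
      liftMap F (σ.comp (algebraMap k K)) := by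
    funext y i
    simp only [liftMap, eval₂_map]
  simp only [green, this]

end BaseChange

/-! ### Bounds for the values of forms -/

section EvalBounds

variable {K : Type u} [Field K] {N : ℕ} {C : Type*} [NormedField C]

theorem norm_prod_pow_le (x : Fin (N + 1) → C) (a : Fin (N + 1) →₀ ℕ) :
    ‖a.prod fun i e => x i ^ e‖ ≤ ‖x‖ ^ a.degree := by
  rw [Finsupp.prod, norm_prod, Finsupp.degree_apply, ← Finset.prod_pow_eq_pow_sum]
  refine Finset.prod_le_prod (fun _ _ => norm_nonneg _) fun i _ => ?_
  rw [norm_pow]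
  exact pow_le_pow_left₀ (norm_nonneg _) (norm_le_pi_norm x i) _

theorem norm_eval₂_le_sum (σ : K →+* C) {p : MvPolynomial (Fin (N + 1)) K} {m : ℕ}
    (hp : p.IsHomogeneous m) (x : Fin (N + 1) → C) :
    ‖eval₂ σ x p‖ ≤ (∑ a ∈ p.support, ‖σ (p.coeff a)‖) * ‖x‖ ^ m := by
  rw [eval₂_eq, Finset.sum_mul]
  refine (norm_sum_le _ _).trans (Finset.sum_le_sum fun a ha => ?_)
  rw [norm_mul]
  refine mul_le_mul_of_nonneg_left ?_ (norm_nonneg _)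
  have h := norm_prod_pow_le x a
  rwa [Finsupp.degree_apply, ← hp.degree_eq_sum_deg_support ha] at h

theorem norm_eval₂_le_of_ultrametric [IsUltrametricDist C] (σ : K →+* C)
    {p : MvPolynomial (Fin (N + 1)) K} {m : ℕ} (hp : p.IsHomogeneous m) {H : ℝ} (hH : 0 ≤ H)
    (hc : ∀ a, ‖σ (p.coeff a)‖ ≤ H) (x : Fin (N + 1) → C) :
    ‖eval₂ σ x p‖ ≤ H * ‖x‖ ^ m := by
  rw [eval₂_eq]
  refine IsUltrametricDist.norm_sum_le_of_forall_le_of_nonneg (by positivity) fun a ha => ?_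
  rw [norm_mul]
  refine mul_le_mul (hc a) ?_ (norm_nonneg _) hH
  have h := norm_prod_pow_le x a
  rwa [Finsupp.degree_apply, ← hp.degree_eq_sum_deg_support ha] at h

theorem norm_le_one_of_isIntegral [IsUltrametricDist C] {R : Type*} [CommRing R] (σ : R →+* C)
    {z : R} (hz : IsIntegral ℤ z) : ‖σ z‖ ≤ 1 := by
  have h1 : IsIntegral ℤ (σ z) := hz.map σ.toIntAlgHom
  have h2 : IsIntegral (NormedField.valuation (K := C)).integer (σ z) := h1.tower_top
  have h3 := Valuation.Integers.mem_of_integral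
    (Valuation.integer.integers (NormedField.valuation (K := C))) h2
  exact_mod_cast h3

end EvalBounds

/-! ### The Nullstellensatz for the lift, with uniform constants -/

section Nullstellensatz

variable {k : Type u} [Field k] {N : ℕ}

theorem homogeneousComponent_mul_of_isHomogeneous {b : MvPolynomial (Fin (N + 1)) k} {i : ℕ}
    (hb : b.IsHomogeneous i) (n : ℕ) (a : MvPolynomial (Fin (N + 1)) k) :
    homogeneousComponent n (a * b) = if i ≤ n then homogeneousComponent (n - i) a * b else 0 := by
  conv_lhs => rw [← sum_homogeneousComponent a, Finset.sum_mul, map_sum]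
  have h : ∀ j, homogeneousComponent n (homogeneousComponent j a * b) =
      if n = j + i then homogeneousComponent j a * b else 0 := fun j =>
    homogeneousComponent_of_mem ((homogeneousComponent_isHomogeneous j a).mul hb)
  simp only [h]
  split_ifs with hi
  · rw [Finset.sum_eq_single (n - i), if_pos (by omega)]
    · exact fun j _ hj => if_neg (by omega)
    · intro hj
      rw [if_pos (by omega), homogeneousComponent_eq_zero _ _ (by simp at hj; omega), zero_mul]
  · exact Finset.sum_eq_zero fun j _ => if_neg (by omega)

/-- A power of each coordinate is a combination of the forms `F_j`. -/
theorem exists_pow_X_eq_sum {F : Fin (N + 1) → MvPolynomial (Fin (N + 1)) k} {d : ℕ}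
    (hF : ∀ i, (F i).IsHomogeneous d)
    (hFzero : ∀ x : Fin (N + 1) → AlgebraicClosure k, (∀ i, aeval x (F i) = 0) → x = 0) :
    ∃ t, d ≤ t ∧ 1 ≤ t ∧ ∃ g : Fin (N + 1) → Fin (N + 1) → MvPolynomial (Fin (N + 1)) k,
      (∀ i j, (g i j).IsHomogeneous (t - d)) ∧ ∀ i, X i ^ t = ∑ j, g i j * F j := by
  have hrad : ∀ i, (X i : MvPolynomial (Fin (N + 1)) k) ∈ (Ideal.span (Set.range F)).radical := by
    intro i
    rw [← vanishingIdeal_zeroLocus_eq_radical (K := AlgebraicClosure k)]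
    intro x hx
    have : x = 0 := hFzero x fun j => hx _ (Ideal.subset_span ⟨j, rfl⟩)
    simp [this]
  choose r hr using fun i => (hrad i : ∃ n : ℕ, _)
  have ht : ∀ i, r i ≤ ∑ i, r i + d + 1 := fun i =>
    (Finset.single_le_sum (fun _ _ => Nat.zero_le _) (Finset.mem_univ i)).trans (by omega)
  have hdt : d ≤ ∑ i, r i + d + 1 := by omega
  refine ⟨∑ i, r i + d + 1, hdt, by omega, ?_⟩
  generalize ∑ i, r i + d + 1 = t at ht hdt
  have hmem : ∀ i, (X i : MvPolynomial (Fin (N + 1)) k) ^ t ∈ Ideal.span (Set.range F) := fun i =>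
    Ideal.pow_mem_of_pow_mem _ (hr i) (ht i)
  choose c hc using fun i => (Ideal.mem_span_range_iff_exists_fun.mp (hmem i))
  refine ⟨fun i j => homogeneousComponent (t - d) (c i j),
    fun i j => homogeneousComponent_isHomogeneous _ _, fun i => ?_⟩
  have h1 := congrArg (homogeneousComponent t) (hc i)
  rw [homogeneousComponent_eq_self (isHomogeneous_X_pow i t), map_sum] at h1
  rw [← h1]
  refine Finset.sum_congr rfl fun j _ => ?_
  rw [homogeneousComponent_mul_of_isHomogeneous (hF j), if_pos hdt]

end Nullstellensatz

section Constants

variable {k : Type u} [Field k] {N : ℕ}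

theorem exists_norm_eq_norm_coord {C : Type*} [NormedField C] (x : Fin (N + 1) → C) :
    ∃ i, ‖x‖ = ‖x i‖ := by
  obtain ⟨i, -, hi⟩ := Finset.exists_mem_eq_sup' (Finset.univ_nonempty)
    fun i : Fin (N + 1) => ‖x i‖
  refine ⟨i, le_antisymm ?_ (norm_le_pi_norm x i)⟩
  rw [pi_norm_le_iff_of_nonneg (norm_nonneg _), ← hi]
  exact fun j => Finset.le_sup' (fun i => ‖x i‖) (Finset.mem_univ j)

theorem normGrowth_of_bounds {C : Type*} [NormedField C]
    {F : Fin (N + 1) → MvPolynomial (Fin (N + 1)) k} {d t : ℕ} (hdt : d ≤ t)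
    (hd : 1 ≤ d) {σ : k →+* C} {H : ℝ}
    (hH : 1 ≤ H) (hup : ∀ x i, ‖eval₂ σ x (F i)‖ ≤ H * ‖x‖ ^ d)
    (hlow : ∀ x i, ‖x i‖ ^ t ≤ H * ‖x‖ ^ (t - d) * ‖liftMap F σ x‖) : NormGrowth F d σ H where
  one_le := hH
  upper x := by
    refine (pi_norm_le_iff_of_nonneg (by positivity)).mpr fun i => hup x i
  lower x := by
    rcases eq_or_ne x 0 with rfl | hx
    · rw [norm_zero, zero_pow (by omega)]
      positivity
    · have hx' := norm_pos_iff.mpr hx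
      obtain ⟨i, hi⟩ := exists_norm_eq_norm_coord x
      have h := hlow x i
      rw [← hi] at h
      have e : ‖x‖ ^ t = ‖x‖ ^ (t - d) * ‖x‖ ^ d := by rw [← pow_add, Nat.sub_add_cancel hdt]
      rw [e, mul_comm H, mul_assoc] at h
      exact le_of_mul_le_mul_left h (pow_pos hx' _)

/-- Finitely many algebraic numbers have a common denominator, which bounds their absolute values
under all embeddings in all `ℂ_p`. -/
theorem exists_nat_norm_le_inv {Ω : Type*} [Field Ω] [CharZero Ω] [Algebra.IsAlgebraic ℚ Ω]
    (s : Finset Ω) : ∃ B : ℕ, 0 < B ∧ ∀ z ∈ s, ∀ (p : ℕ) [Fact p.Prime] (σ : Ω →+* ℂ_[p]),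
      ‖σ z‖ ≤ ‖(B : ℂ_[p])‖⁻¹ := by
  have : Algebra.IsAlgebraic ℤ Ω := (IsFractionRing.comap_isAlgebraic_iff (A := ℤ) (K := ℚ)).mpr ‹_›
  obtain ⟨y, hy, hys⟩ := Algebra.IsAlgebraic.exists_integral_multiples ℤ s
  refine ⟨y.natAbs, Int.natAbs_pos.mpr hy, fun z hz p _ σ => ?_⟩
  have h := norm_le_one_of_isIntegral σ (hys z hz)
  have hB : ‖((y.natAbs : ℕ) : ℂ_[p])‖ = ‖(y : ℂ_[p])‖ := by
    rcases Int.natAbs_eq y with h | h <;> rw [h] <;> simp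
  have hpos : 0 < ‖(y : ℂ_[p])‖ := norm_pos_iff.mpr (by exact_mod_cast hy)
  rw [zsmul_eq_mul, map_mul, map_intCast, norm_mul] at h
  rw [hB, ← one_div, le_div_iff₀ hpos]
  linarith

theorem one_le_inv_norm_natCast {p : ℕ} [Fact p.Prime] {B : ℕ} (hB : 0 < B) :
    1 ≤ ‖(B : ℂ_[p])‖⁻¹ := by
  refine (one_le_inv₀ (norm_pos_iff.mpr (by exact_mod_cast hB.ne'))).mpr ?_
  exact_mod_cast IsUltrametricDist.norm_intCast_le_one ℂ_[p] B

variable [NumberField k]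

theorem exists_padic_bound (s : Finset (MvPolynomial (Fin (N + 1)) k)) :
    ∃ B : ℕ, 0 < B ∧ ∀ q ∈ s, ∀ (p : ℕ) [Fact p.Prime] (σ : k →+* ℂ_[p]) (a),
      ‖σ (q.coeff a)‖ ≤ ‖(B : ℂ_[p])‖⁻¹ := by
  classical
  obtain ⟨B, hB, h⟩ := exists_nat_norm_le_inv
    (s.biUnion fun q => q.support.image fun a => q.coeff a)
  refine ⟨B, hB, fun q hq p _ σ a => ?_⟩
  by_cases ha : a ∈ q.support
  · exact h _ (Finset.mem_biUnion.mpr ⟨q, hq, Finset.mem_image_of_mem _ ha⟩) p σ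
  · rw [notMem_support_iff.mp ha, map_zero, norm_zero]
    positivity

theorem exists_complex_bound (s : Finset (MvPolynomial (Fin (N + 1)) k)) :
    ∃ A : ℝ, 1 ≤ A ∧ ∀ q ∈ s, ∀ σ : k →+* ℂ, ∑ a ∈ q.support, ‖σ (q.coeff a)‖ ≤ A := by
  refine ⟨1 + ∑ q ∈ s, ∑ σ : k →+* ℂ, ∑ a ∈ q.support, ‖σ (q.coeff a)‖, ?_, fun q hq σ => ?_⟩
  · have : 0 ≤ ∑ q ∈ s, ∑ σ : k →+* ℂ, ∑ a ∈ q.support, ‖σ (q.coeff a)‖ := by positivity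
    linarith
  · have h1 : ∑ a ∈ q.support, ‖σ (q.coeff a)‖ ≤
        ∑ σ : k →+* ℂ, ∑ a ∈ q.support, ‖σ (q.coeff a)‖ :=
      Finset.single_le_sum (f := fun σ : k →+* ℂ => ∑ a ∈ q.support, ‖σ (q.coeff a)‖)
        (fun _ _ => by positivity) (Finset.mem_univ σ)
    have h2 := Finset.single_le_sum
      (f := fun q => ∑ σ : k →+* ℂ, ∑ a ∈ q.support, ‖σ (q.coeff a)‖)
      (fun _ _ => by positivity) hq
    linarith

/-- The growth constants of `F` can be taken to be one real number at all archimedean places and the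
inverse absolute values of one natural number at all non-archimedean places. -/
theorem exists_uniform_normGrowth {F : Fin (N + 1) → MvPolynomial (Fin (N + 1)) k} {d : ℕ}
    (hd : 1 ≤ d) (hF : ∀ i, (F i).IsHomogeneous d)
    (hFzero : ∀ x : Fin (N + 1) → AlgebraicClosure k, (∀ i, aeval x (F i) = 0) → x = 0) :
    (∃ A : ℝ, ∀ σ : k →+* ℂ, NormGrowth F d σ A) ∧
      ∃ B : ℕ, 0 < B ∧ ∀ (p : ℕ) [Fact p.Prime] (σ : k →+* ℂ_[p]),
        NormGrowth F d σ ‖(B : ℂ_[p])‖⁻¹ := by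
  classical
  obtain ⟨t, hdt, -, g, hg, hgF⟩ := exists_pow_X_eq_sum hF hFzero
  have hev : ∀ {C : Type} [NormedField C] (σ : k →+* C) (x : Fin (N + 1) → C) (i),
      x i ^ t = ∑ j, eval₂ σ x (g i j) * liftMap F σ x j := by
    intro C _ σ x i
    have := congrArg (eval₂ σ x) (hgF i)
    simpa only [eval₂_pow, eval₂_X, eval₂_sum, eval₂_mul, liftMap] using this
  constructor
  · obtain ⟨A, hA, h⟩ := exists_complex_bound
      (Finset.univ.image F ∪ Finset.univ.image fun ij : Fin (N + 1) × Fin (N + 1) => g ij.1 ij.2)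
    refine ⟨(N + 1) * A, fun σ => normGrowth_of_bounds hdt hd ?_ (fun x i => ?_) fun x i => ?_⟩
    · nlinarith
    · refine (norm_eval₂_le_sum σ (hF i) x).trans ?_
      have h1 := h (F i) (by simp) σ
      gcongr
      nlinarith
    · rw [← norm_pow, hev σ x i]
      refine (norm_sum_le _ _).trans ?_
      have : ∀ j ∈ Finset.univ, ‖eval₂ σ x (g i j) * liftMap F σ x j‖ ≤
          A * ‖x‖ ^ (t - d) * ‖liftMap F σ x‖ := by
        intro j _
        rw [norm_mul]
        refine mul_le_mul ((norm_eval₂_le_sum σ (hg i j) x).trans ?_) (norm_le_pi_norm _ j)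
          (norm_nonneg _) (by positivity)
        gcongr
        exact h (g i j) (Finset.mem_union_right _ (Finset.mem_image.mpr ⟨(i, j), by simp⟩)) σ
      refine (Finset.sum_le_card_nsmul _ _ _ this).trans (le_of_eq ?_)
      simp
      ring
  · obtain ⟨B, hB, h⟩ := exists_padic_bound
      (Finset.univ.image F ∪ Finset.univ.image fun ij : Fin (N + 1) × Fin (N + 1) => g ij.1 ij.2)
    refine ⟨B, hB, fun p _ σ => normGrowth_of_bounds hdt hd
      (one_le_inv_norm_natCast hB) (fun x i => ?_) fun x i => ?_⟩
    · exact norm_eval₂_le_of_ultrametric σ (hF i) (by positivity)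
        (h (F i) (by simp) p σ) x
    · rw [← norm_pow, hev σ x i]
      refine IsUltrametricDist.norm_sum_le_of_forall_le_of_nonneg (by positivity) fun j _ => ?_
      rw [norm_mul]
      refine mul_le_mul ?_ (norm_le_pi_norm _ j) (norm_nonneg _) (by positivity)
      exact norm_eval₂_le_of_ultrametric σ (hg i j) (by positivity)
        (h (g i j) (Finset.mem_union_right _ (Finset.mem_image.mpr ⟨(i, j), by simp⟩)) p σ) x

end Constants

/-! ### Spanning the forms by products of iterates with small norms -/

section SmallForms

variable {k : Type u} [Field k] {N : ℕ}

/-- The forms of degree `m` over `k` whose norm with respect to the canonical metric is at most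
`H ^ E`, for every absolute value for which `H` is a growth constant of `F`. -/
def smallForms (F : Fin (N + 1) → MvPolynomial (Fin (N + 1)) k) (d m E : ℕ) :
    Set (MvPolynomial (Fin (N + 1)) k) :=
  {q | q.IsHomogeneous m ∧ ∀ (C : Type) [NormedField C] (σ : k →+* C) (H : ℝ),
    NormGrowth F d σ H → ∀ x : Fin (N + 1) → C, x ≠ 0 →
      ‖eval₂ σ x q‖ ≤ H ^ E * Real.exp (m * green F d σ x)}

theorem norm_eval₂_monomial_le {F : Fin (N + 1) → MvPolynomial (Fin (N + 1)) k} {d : ℕ}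
    (hd : 2 ≤ d) {C : Type*} [NormedField C] {σ : k →+* C} {H : ℝ} (h : NormGrowth F d σ H)
    {x : Fin (N + 1) → C} (hx : x ≠ 0) (a : Fin (N + 1) →₀ ℕ) {T : ℕ} (hT : a.degree ≤ T) :
    ‖eval₂ σ x (monomial a 1)‖ ≤ H ^ T * Real.exp (a.degree * green F d σ x) := by
  rw [eval₂_monomial, map_one, one_mul]
  refine (norm_prod_pow_le x a).trans ((pow_le_pow_left₀ (norm_nonneg _)
    (h.norm_le hd hx) _).trans ?_)
  rw [mul_pow, ← Real.exp_nat_mul]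
  gcongr
  exact h.one_le

theorem eval₂_bind₁ {C : Type*} [NormedField C] (F : Fin (N + 1) → MvPolynomial (Fin (N + 1)) k)
    (σ : k →+* C) (x : Fin (N + 1) → C) (Q : MvPolynomial (Fin (N + 1)) k) :
    eval₂ σ x (bind₁ F Q) = eval₂ σ (liftMap F σ x) Q := by
  rw [← coe_eval₂Hom, ← coe_eval₂Hom, eval₂Hom_bind₁]
  rfl

/-- If `m` is large then every monomial of degree `m` lies in the ideal generated by the forms
`F_j`. -/
theorem monomial_eq_sum_mul {F : Fin (N + 1) → MvPolynomial (Fin (N + 1)) k} {d t : ℕ}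
    {g : Fin (N + 1) → Fin (N + 1) → MvPolynomial (Fin (N + 1)) k} (ht : 1 ≤ t) (hdt : d ≤ t)
    (hg : ∀ i j, (g i j).IsHomogeneous (t - d)) (hgF : ∀ i, X i ^ t = ∑ j, g i j * F j)
    {a : Fin (N + 1) →₀ ℕ} (ha : (N + 1) * t ≤ a.degree) :
    ∃ h : Fin (N + 1) → MvPolynomial (Fin (N + 1)) k,
      (∀ j, (h j).IsHomogeneous (a.degree - d)) ∧ monomial a 1 = ∑ j, h j * F j := by
  obtain ⟨i, hi⟩ : ∃ i, t ≤ a i := by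
    by_contra! hlt
    have : a.degree ≤ ∑ _i : Fin (N + 1), (t - 1) := by
      rw [Finsupp.degree_eq_sum]
      exact Finset.sum_le_sum fun i _ => by have := hlt i; omega
    rw [Finset.sum_const, Finset.card_univ, Fintype.card_fin, smul_eq_mul] at this
    have h2 : (N + 1) * (t - 1) < (N + 1) * t := Nat.mul_lt_mul_of_pos_left (by omega) (by omega)
    omega
  have hle : Finsupp.single i t ≤ a := Finsupp.single_le_iff.mpr hi
  have hdeg : (a - Finsupp.single i t).degree + t = a.degree := by
    conv_rhs => rw [← tsub_add_cancel_of_le hle]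
    rw [map_add, Finsupp.degree_single]
  refine ⟨fun j => monomial (a - Finsupp.single i t) 1 * g i j, fun j => ?_, ?_⟩
  · have := (isHomogeneous_monomial (1 : k) (rfl : (a - Finsupp.single i t).degree = _)).mul (hg i j)
    convert this using 1
    omega
  · have : monomial a (1 : k) = monomial (a - Finsupp.single i t) 1 * X i ^ t := by
      rw [X_pow_eq_monomial, monomial_mul, tsub_add_cancel_of_le hle, mul_one]
    rw [this, hgF i, Finset.mul_sum]
    exact Finset.sum_congr rfl fun j _ => by ring

theorem mem_span_monomials {p : MvPolynomial (Fin (N + 1)) k} {m : ℕ} (hp : p.IsHomogeneous m)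
    {S : Submodule k (MvPolynomial (Fin (N + 1)) k)}
    (hS : ∀ a : Fin (N + 1) →₀ ℕ, a.degree = m → monomial a 1 ∈ S) : p ∈ S := by
  rw [p.as_sum]
  refine S.sum_mem fun a ha => ?_
  have : monomial a (p.coeff a) = p.coeff a • monomial a (1 : k) := by
    rw [smul_monomial, smul_eq_mul, mul_one]
  rw [this]
  refine S.smul_mem _ (hS a ?_)
  rw [Finsupp.degree_apply, ← hp.degree_eq_sum_deg_support ha]

/-- The polynomial ring is generated, as a module over the subring generated by the forms `F_j`, by
the monomials of bounded degree. -/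
theorem mem_span_monomial_mul_bind₁ {F : Fin (N + 1) → MvPolynomial (Fin (N + 1)) k} {d t : ℕ}
    {g : Fin (N + 1) → Fin (N + 1) → MvPolynomial (Fin (N + 1)) k} (ht : 1 ≤ t) (hd : 1 ≤ d)
    (hdt : d ≤ t)
    (hg : ∀ i j, (g i j).IsHomogeneous (t - d)) (hgF : ∀ i, X i ^ t = ∑ j, g i j * F j) (m : ℕ) :
    ∀ p : MvPolynomial (Fin (N + 1)) k, p.IsHomogeneous m →
      p ∈ Submodule.span k {q | ∃ (a : Fin (N + 1) →₀ ℕ) (j : ℕ) (Q : MvPolynomial _ k),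
        a.degree ≤ (N + 1) * t ∧ a.degree + d * j = m ∧ Q.IsHomogeneous j ∧
          q = monomial a 1 * bind₁ F Q} := by
  induction m using Nat.strong_induction_on with
  | _ m ih =>
    intro p hp
    refine mem_span_monomials hp fun a ha => ?_
    by_cases hT : a.degree ≤ (N + 1) * t
    · refine Submodule.subset_span ⟨a, 0, 1, hT, by omega, isHomogeneous_one _ _, by simp⟩
    · obtain ⟨h, hh, hhF⟩ := monomial_eq_sum_mul ht hdt hg hgF (a := a) (by omega)
      rw [hhF]
      refine Submodule.sum_mem _ fun j _ => ?_
      have htm : t ≤ m := by nlinarith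
      have h1 := ih (m - d) (by omega) (h j) (by rw [← ha]; exact hh j)
      have h2 := Submodule.apply_mem_span_image_of_mem_span
        (LinearMap.mulRight k (F j)) h1
      refine Submodule.span_mono ?_ h2
      rintro _ ⟨_, ⟨b, i, Q, hb, hbi, hQ, rfl⟩, rfl⟩
      refine ⟨b, i + 1, Q * X j, hb, ?_, hQ.mul (isHomogeneous_X k j), ?_⟩
      · rw [mul_add]
        omega
      · simp only [LinearMap.mulRight_apply, map_mul, bind₁_X_right]
        ring

/-- Forms of degree at most `d ^ n` are spanned by forms whose norms grow only linearly in the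
exponent `n`. They are products of monomials of bounded degree in the coordinates of the iterates
`F^j`, for `j ≤ n`. -/
theorem exists_mem_span_smallForms {F : Fin (N + 1) → MvPolynomial (Fin (N + 1)) k} {d : ℕ}
    (hd : 2 ≤ d) (hF : ∀ i, (F i).IsHomogeneous d)
    (hFzero : ∀ x : Fin (N + 1) → AlgebraicClosure k, (∀ i, aeval x (F i) = 0) → x = 0) :
    ∃ T : ℕ, ∀ n m : ℕ, m ≤ d ^ n → ∀ p : MvPolynomial (Fin (N + 1)) k, p.IsHomogeneous m →
      p ∈ Submodule.span k (smallForms F d m (T * (n + 1))) := by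
  obtain ⟨t, hdt, ht, g, hg, hgF⟩ := exists_pow_X_eq_sum hF hFzero
  refine ⟨(N + 1) * t, fun n => ?_⟩
  induction n with
  | zero =>
    intro m hm p hp
    refine mem_span_monomials hp fun a ha => Submodule.subset_span
      ⟨isHomogeneous_monomial _ ha, fun C _ σ H h x hx => ?_⟩
    subst ha
    refine norm_eval₂_monomial_le hd h hx a ?_
    rw [pow_zero] at hm
    nlinarith
  | succ n ih =>
    intro m hm p hp
    refine Submodule.span_le.mpr ?_
      (mem_span_monomial_mul_bind₁ ht (by omega) hdt hg hgF m p hp)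
    rintro _ ⟨a, j, Q, ha, hj, hQ, rfl⟩
    have hjn : j ≤ d ^ n := by
      rw [pow_succ'] at hm
      exact le_of_mul_le_mul_left (by omega : d * j ≤ d * d ^ n) (by omega)
    have h2 := Submodule.apply_mem_span_image_of_mem_span
      ((LinearMap.mulLeft k (monomial a (1 : k))) ∘ₗ (bind₁ F).toLinearMap) (ih j hjn Q hQ)
    refine Submodule.span_mono ?_ h2
    rintro _ ⟨q, ⟨hq, hqn⟩, rfl⟩
    simp only [LinearMap.comp_apply, AlgHom.toLinearMap_apply, LinearMap.mulLeft_apply]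
    refine ⟨?_, fun C _ σ H h x hx => ?_⟩
    · rw [← hj]
      refine (isHomogeneous_monomial _ rfl).mul ?_
      exact hq.aeval _ hF
    · rw [eval₂_mul, norm_mul, eval₂_bind₁]
      have h1 := norm_eval₂_monomial_le hd h hx a ha
      have h3 := hqn C σ H h _ (h.liftMap_ne_zero hx)
      rw [h.green_liftMap hd hx] at h3
      have hH : 0 ≤ H := zero_le_one.trans h.one_le
      refine (mul_le_mul h1 h3 (norm_nonneg _) (by positivity)).trans (le_of_eq ?_)
      rw [mul_mul_mul_comm, ← pow_add, ← Real.exp_add, ← hj]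
      push_cast
      ring_nf

end SmallForms

/-! ### Sections of large degree are restrictions of forms -/

section Sections

/-- The integral closure of a finitely generated domain over a field of characteristic zero in its
fraction field is finite, stated for submodules of the fraction field. -/
theorem fg_of_forall_isIntegral (k : Type*) [Field k] [CharZero k] (R : Type*) [CommRing R]
    [IsDomain R] [Algebra k R] [Algebra.FiniteType k R] (U : Submodule R (FractionRing R))
    (hU : ∀ f ∈ U, IsIntegral R f) : U.FG := by
  obtain ⟨s, g, hginj, hgfin⟩ := exists_finite_inj_algHom_of_fg k R
  let A := MvPolynomial (Fin s) k
  let : Algebra A R := g.toRingHom.toAlgebra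
  have : Module.Finite A R := hgfin
  have : FaithfulSMul A R := (faithfulSMul_iff_algebraMap_injective A R).mpr hginj
  have : FaithfulSMul A (FractionRing R) := FaithfulSMul.trans A R (FractionRing R)
  let : Algebra (FractionRing A) (FractionRing R) := FractionRing.liftAlgebra A _
  have := FractionRing.isScalarTower_liftAlgebra A (FractionRing R)
  have : Module.Finite (FractionRing A) (FractionRing R) :=
    Module.Finite.of_isLocalization A R (nonZeroDivisors A)
  have : CharZero (FractionRing A) := 
    charZero_of_injective_algebraMap (IsFractionRing.injective A (FractionRing A))
  have hN : IsNoetherian A (integralClosure A (FractionRing R)) :=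
    IsIntegralClosure.isNoetherian A (FractionRing A) (FractionRing R) _
  have hint : Algebra.IsIntegral A R := inferInstance
  refine Submodule.FG.of_restrictScalars A ?_
  have hle : U.restrictScalars A ≤ Subalgebra.toSubmodule (integralClosure A (FractionRing R)) := by
    intro f hf
    exact isIntegral_trans (R := A) (A := R) f (hU f hf)
  have : IsNoetherian A (Subalgebra.toSubmodule (integralClosure A (FractionRing R))) := hN
  exact (isNoetherian_submodule.mp this) _ hle

variable {k : Type u} [Field k] {N : ℕ} (I : Ideal (MvPolynomial (Fin (N + 1)) k))

/-- The class of a polynomial in the function field of the affine cone over `X = V₊(I)`. -/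
noncomputable def coneFraction : MvPolynomial (Fin (N + 1)) k →+* FractionRing (CoordRing I) :=
  (algebraMap (CoordRing I) (FractionRing (CoordRing I))).comp (Ideal.Quotient.mk I)

variable {I}

theorem coneFraction_eq_iff {p q : MvPolynomial (Fin (N + 1)) k} :
    coneFraction I p = coneFraction I q ↔ p - q ∈ I := by
  rw [coneFraction, RingHom.comp_apply, RingHom.comp_apply,
    (IsFractionRing.injective (CoordRing I) _).eq_iff, Ideal.Quotient.eq]

theorem coneFraction_ne_zero {p : MvPolynomial (Fin (N + 1)) k} (hp : p ∉ I) :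
    coneFraction I p ≠ 0 := by
  rw [← map_zero (coneFraction I), Ne, coneFraction_eq_iff, sub_zero]
  exact hp

variable [I.IsPrime]

/-- The rational function `f` on the affine cone is a section of `O_X(m)`: over each chart
`x_i ≠ 0` it is a fraction `q / x_i ^ s` with `q` homogeneous of degree `m + s`. -/
def IsRationalSection (I : Ideal (MvPolynomial (Fin (N + 1)) k)) [I.IsPrime] (m : ℕ)
    (f : FractionRing (CoordRing I)) : Prop :=
  ∀ i, ∃ (s : ℕ) (q : MvPolynomial (Fin (N + 1)) k), q.IsHomogeneous (m + s) ∧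
    coneFraction I (X i) ^ s * f = coneFraction I q

/-- As `m` is not negative, multiplication by a section of `O_X(m)` preserves a power of the
irrelevant ideal. -/
theorem IsRationalSection.exists_pow_mul {m : ℕ} {f : FractionRing (CoordRing I)}
    (hf : IsRationalSection I m f) : ∃ A : ℕ, ∀ h ∈ idealOfVars (Fin (N + 1)) k ^ A,
      ∃ g ∈ idealOfVars (Fin (N + 1)) k ^ A, coneFraction I h * f = coneFraction I g := by
  choose s q hq hqf using hf
  refine ⟨∑ i, s i, fun h hh => ?_⟩
  rw [pow_idealOfVars_eq_span] at hh
  induction hh using Submodule.span_induction with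
  | zero => exact ⟨0, zero_mem _, by simp⟩
  | add x y _ _ hx hy =>
    obtain ⟨g, hg, hgf⟩ := hx
    obtain ⟨g', hg', hgf'⟩ := hy
    exact ⟨g + g', add_mem hg hg', by rw [map_add, map_add, add_mul, hgf, hgf']⟩
  | smul c x _ hx =>
    obtain ⟨g, hg, hgf⟩ := hx
    exact ⟨c * g, Ideal.mul_mem_left _ _ hg, by
      rw [smul_eq_mul, map_mul, map_mul, mul_assoc, hgf]⟩
  | mem x hx =>
    obtain ⟨a, ha, rfl⟩ := hx
    replace ha : a.degree = ∑ i, s i := ha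
    obtain ⟨i, hi⟩ : ∃ i, s i ≤ a i := by
      by_contra! hlt
      rw [Finsupp.degree_eq_sum] at ha
      exact absurd ha (Finset.sum_lt_sum_of_nonempty Finset.univ_nonempty fun i _ => hlt i).ne
    have hle : Finsupp.single i (s i) ≤ a := Finsupp.single_le_iff.mpr hi
    have hdeg : (a - Finsupp.single i (s i)).degree + s i = a.degree := by
      conv_rhs => rw [← tsub_add_cancel_of_le hle]
      rw [map_add, Finsupp.degree_single]
    refine ⟨monomial (a - Finsupp.single i (s i)) 1 * q i, ?_, ?_⟩
    · have hhom := (isHomogeneous_monomial (1 : k)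
        (rfl : (a - Finsupp.single i (s i)).degree = _)).mul (hq i)
      rw [mem_pow_idealOfVars_iff']
      intro b hb
      by_contra hne
      have := hhom.degree_eq_sum_deg_support (mem_support_iff.mpr hne)
      rw [← Finsupp.degree_apply] at this
      omega
    · have : monomial a (1 : k) = monomial (a - Finsupp.single i (s i)) 1 * X i ^ s i := by
        rw [X_pow_eq_monomial, monomial_mul, tsub_add_cancel_of_le hle, mul_one]
      change coneFraction I (monomial a 1) * f = _
      rw [this, map_mul, map_mul, map_pow, mul_assoc, hqf]

theorem IsRationalSection.isIntegral {i₀ : Fin (N + 1)} (hi₀ : X i₀ ∉ I) {m : ℕ}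
    {f : FractionRing (CoordRing I)} (hf : IsRationalSection I m f) :
    IsIntegral (CoordRing I) f := by
  obtain ⟨A, hA⟩ := hf.exists_pow_mul
  refine isIntegral_of_smul_mem_submodule
    (Submodule.map (Algebra.linearMap (CoordRing I) (FractionRing (CoordRing I)))
      ((idealOfVars (Fin (N + 1)) k ^ A).map (Ideal.Quotient.mk I))) ?_ ?_ f ?_
  · rw [Submodule.ne_bot_iff]
    refine ⟨coneFraction I (X i₀ ^ A), ⟨Ideal.Quotient.mk I (X i₀ ^ A),
      Ideal.mem_map_of_mem _ (Ideal.pow_mem_pow (Ideal.subset_span (Set.mem_range_self i₀)) A),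
      rfl⟩, ?_⟩
    rw [map_pow]
    exact pow_ne_zero _ (coneFraction_ne_zero hi₀)
  · exact ((IsNoetherian.noetherian _ : Submodule.FG _).map _)
  · rintro _ ⟨y, hy, rfl⟩
    obtain ⟨h, hh, rfl⟩ := (Ideal.mem_map_iff_of_surjective _ Ideal.Quotient.mk_surjective).mp hy
    obtain ⟨g, hg, hgf⟩ := hA h hh
    refine ⟨Ideal.Quotient.mk I g, Ideal.mem_map_of_mem _ hg, ?_⟩
    rw [smul_eq_mul, mul_comm]
    exact hgf.symm

/-- A section of `O_X(m)` for large `m` that is the fraction `P / x_{i₀} ^ r` is the class of a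
form. -/
theorem exists_forall_isRationalSection [CharZero k]
    (hI : ∀ p ∈ I, ∀ m : ℕ, homogeneousComponent m p ∈ I) {i₀ : Fin (N + 1)} (hi₀ : X i₀ ∉ I) :
    ∃ m₀ : ℕ, ∀ (m : ℕ) (f : FractionRing (CoordRing I)), m₀ ≤ m → IsRationalSection I m f →
      ∃ g : MvPolynomial (Fin (N + 1)) k, g.IsHomogeneous m ∧ f = coneFraction I g := by
  classical
  have hfg := fg_of_forall_isIntegral k (CoordRing I)
    (Submodule.span _ {f | ∃ m, IsRationalSection I m f}) fun f hf => by
      refine Submodule.span_le (p := Subalgebra.toSubmodule (integralClosure _ _)) |>.mpr ?_ hf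
      rintro f ⟨m, hm⟩
      exact hm.isIntegral hi₀
  obtain ⟨T, hTS, hT⟩ := (Submodule.fg_span_iff_fg_span_finset_subset _).mp hfg
  choose! deg hdeg using fun f (hf : f ∈ T) => hTS hf
  choose! A hA using fun f (hf : f ∈ T) => (hdeg f hf).exists_pow_mul
  choose! s q hq hqf using fun f (hf : f ∈ T) => hdeg f hf i₀
  refine ⟨∑ f ∈ T, (deg f + A f), fun m f hm hf => ?_⟩
  have hbound : ∀ t ∈ T, deg t + A t ≤ m := fun t ht =>
    (Finset.single_le_sum (f := fun f => deg f + A f) (fun _ _ => Nat.zero_le _) ht).trans hm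
  obtain ⟨r, P, hP, hPf⟩ := hf i₀
  have hfT : f ∈ Submodule.span (CoordRing I) (T : Set (FractionRing (CoordRing I))) :=
    hT ▸ Submodule.subset_span ⟨m, hf⟩
  obtain ⟨c, -, hc⟩ := Submodule.mem_span_finset.mp hfT
  choose G hG using fun t => Ideal.Quotient.mk_surjective (I := I) (c t)
  have hx := coneFraction_ne_zero hi₀
  -- After multiplication by a power of `x_{i₀}` the relation between the sections becomes a
  -- relation between polynomials modulo `I`, whose homogeneous component of the right degree
  -- expresses `f` through coefficients of large degree.
  set ρ := r + ∑ t ∈ T, s t with hρ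
  have hs : ∀ t ∈ T, s t ≤ ρ := fun t ht =>
    (Finset.single_le_sum (f := s) (fun _ _ => Nat.zero_le _) ht).trans (by omega)
  have hrel : coneFraction I (P * X i₀ ^ (ρ - r)) =
      coneFraction I (∑ t ∈ T, G t * (q t * X i₀ ^ (ρ - s t))) := by
    rw [map_mul, ← hPf, map_pow, map_sum]
    calc _ = coneFraction I (X i₀) ^ ρ * f := by
          rw [mul_right_comm, ← pow_add, Nat.add_sub_cancel' (by omega)]
      _ = _ := by
          rw [← hc, Finset.mul_sum]
          refine Finset.sum_congr rfl fun t ht => ?_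
          have hct : c t • t = coneFraction I (G t) * t := by
            rw [← hG t]
            exact Algebra.smul_def (Ideal.Quotient.mk I (G t)) t
          rw [map_mul, map_mul, ← hqf t ht, map_pow, hct,
            mul_right_comm (_ ^ s t), ← pow_add, Nat.add_sub_cancel' (hs t ht)]
          ring
  rw [coneFraction_eq_iff] at hrel
  have hcomp := hI _ hrel (m + ρ)
  rw [map_sub, map_sum, homogeneousComponent_eq_self (by
    have := hP.mul (isHomogeneous_X_pow (R := k) i₀ (ρ - r))
    rwa [add_assoc, Nat.add_sub_cancel' (by omega)] at this)] at hcomp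
  have hterm : ∀ t ∈ T, homogeneousComponent (m + ρ) (G t * (q t * X i₀ ^ (ρ - s t))) =
      homogeneousComponent (m - deg t) (G t) * (q t * X i₀ ^ (ρ - s t)) := by
    intro t ht
    have h1 : (q t * X i₀ ^ (ρ - s t)).IsHomogeneous (deg t + ρ) := by
      have := (hq t ht).mul (isHomogeneous_X_pow (R := k) i₀ (ρ - s t))
      rwa [add_assoc, Nat.add_sub_cancel' (hs t ht)] at this
    have h2 := hbound t ht
    rw [homogeneousComponent_mul_of_isHomogeneous h1, if_pos (by omega),
      show m + ρ - (deg t + ρ) = m - deg t by omega]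
  rw [Finset.sum_congr rfl hterm, ← coneFraction_eq_iff] at hcomp
  have hf' : f = ∑ t ∈ T, coneFraction I (homogeneousComponent (m - deg t) (G t)) * t := by
    refine mul_left_cancel₀ (pow_ne_zero ρ hx) ?_
    rw [map_mul, ← hPf, map_pow, mul_right_comm, ← pow_add, Nat.add_sub_cancel' (by omega)] at hcomp
    rw [hcomp, map_sum, Finset.mul_sum]
    refine Finset.sum_congr rfl fun t ht => ?_
    rw [map_mul, map_mul, ← hqf t ht, map_pow, mul_right_comm (_ ^ s t), ← pow_add,
      Nat.add_sub_cancel' (hs t ht)]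
    ring
  have hmem : ∀ t ∈ T, ∃ g, coneFraction I (homogeneousComponent (m - deg t) (G t)) * t =
      coneFraction I g := by
    intro t ht
    have hGA : homogeneousComponent (m - deg t) (G t) ∈ idealOfVars (Fin (N + 1)) k ^ A t := by
      rw [mem_pow_idealOfVars_iff']
      intro b hb
      have hle := hbound t ht
      have hne : b.degree ≠ m - deg t := fun h => by rw [h] at hb; omega
      rw [coeff_homogeneousComponent, if_neg hne]
    obtain ⟨g, -, hg⟩ := hA t ht _ hGA
    exact ⟨g, hg⟩
  choose! g hg using hmem
  have hfg' : f = coneFraction I (∑ t ∈ T, g t) := by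
    rw [hf', map_sum]
    exact Finset.sum_congr rfl hg
  refine ⟨homogeneousComponent m (∑ t ∈ T, g t), homogeneousComponent_isHomogeneous _ _, ?_⟩
  refine mul_left_cancel₀ (pow_ne_zero r hx) ?_
  rw [hPf, ← map_pow, ← map_mul, coneFraction_eq_iff]
  have h1 : P - (∑ t ∈ T, g t) * X i₀ ^ r ∈ I := by
    rw [← coneFraction_eq_iff, ← hPf, map_mul, ← hfg', map_pow, mul_comm]
  have h2 := hI _ h1 (m + r)
  rw [map_sub, homogeneousComponent_eq_self hP, homogeneousComponent_mul_of_isHomogeneous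
    (isHomogeneous_X_pow (R := k) i₀ r), if_pos (by omega), Nat.add_sub_cancel, mul_comm] at h2
  exact h2

/-- The forms over `X` in large degree, for fractions given by polynomials: if `P / x_{i₀} ^ r` is
regular on all charts and of degree `m`, then its product with `x_{i₀} ^ e` is the class of a form,
once `m + e` is large. -/
theorem exists_forall_fraction_eq_form [CharZero k]
    (hI : ∀ p ∈ I, ∀ m : ℕ, homogeneousComponent m p ∈ I) {i₀ : Fin (N + 1)} (hi₀ : X i₀ ∉ I) :
    ∃ m₀ : ℕ, ∀ (m e r : ℕ) (P : MvPolynomial (Fin (N + 1)) k), m₀ ≤ m + e →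
      P.IsHomogeneous (m + r) → (∀ i, ∃ s q, P * X i ^ s - q * X i₀ ^ r ∈ I) →
        ∃ g : MvPolynomial (Fin (N + 1)) k, g.IsHomogeneous (m + e) ∧
          X i₀ ^ e * P - X i₀ ^ r * g ∈ I := by
  obtain ⟨m₀, h⟩ := exists_forall_isRationalSection hI hi₀
  refine ⟨m₀, fun m e r P hm hP hPq => ?_⟩
  have hx := pow_ne_zero r (coneFraction_ne_zero hi₀)
  obtain ⟨g, hg, hgf⟩ := h (m + e)
    (coneFraction I (X i₀ ^ e * P) / coneFraction I (X i₀) ^ r) hm fun i => by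
      obtain ⟨s, q, hq⟩ := hPq i
      have h1 := hI _ hq (m + r + s)
      rw [map_sub, homogeneousComponent_eq_self (hP.mul (isHomogeneous_X_pow i s)),
        homogeneousComponent_mul_of_isHomogeneous (isHomogeneous_X_pow (R := k) i₀ r),
        if_pos (by omega), ← coneFraction_eq_iff] at h1
      refine ⟨s, X i₀ ^ e * homogeneousComponent (m + r + s - r) q, ?_, ?_⟩
      · have := (isHomogeneous_X_pow (R := k) i₀ e).mul
          (homogeneousComponent_isHomogeneous (m + r + s - r) q)
        convert this using 1
        omega
      · rw [mul_div_assoc', div_eq_iff hx]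
        simp only [map_mul, map_pow] at h1 ⊢
        linear_combination coneFraction I (X i₀) ^ e * h1
  refine ⟨g, hg, ?_⟩
  rw [← coneFraction_eq_iff, map_mul _ (X i₀ ^ r), ← hgf, map_pow _ _ r, mul_div_cancel₀ _ hx]

end Sections

/-! ### Descent of coefficients along `K / k` -/

section Descent

variable {k : Type u} [Field k] {K : Type u} [Field K] [Algebra k K] {N : ℕ}

/-- A `k`-linear functional on `K`, applied to the coefficients of a polynomial. -/
noncomputable def coeffMap (l : K →ₗ[k] k) (p : MvPolynomial (Fin (N + 1)) K) :
    MvPolynomial (Fin (N + 1)) k :=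
  ∑ a ∈ p.support, monomial a (l (p.coeff a))

theorem coeff_coeffMap (l : K →ₗ[k] k) (p : MvPolynomial (Fin (N + 1)) K)
    (a : Fin (N + 1) →₀ ℕ) : (coeffMap l p).coeff a = l (p.coeff a) := by
  classical
  simp only [coeffMap, coeff_sum, coeff_monomial, Finset.sum_ite_eq', mem_support_iff, ne_eq,
    ite_not, ite_eq_right_iff]
  intro h
  rw [h, map_zero]

theorem coeffMap_add (l : K →ₗ[k] k) (p q : MvPolynomial (Fin (N + 1)) K) :
    coeffMap l (p + q) = coeffMap l p + coeffMap l q := by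
  ext a
  simp only [coeff_coeffMap, coeff_add, map_add]

theorem coeffMap_sub (l : K →ₗ[k] k) (p q : MvPolynomial (Fin (N + 1)) K) :
    coeffMap l (p - q) = coeffMap l p - coeffMap l q := by
  ext a
  simp only [coeff_coeffMap, coeff_sub, map_sub]

theorem coeffMap_mul_map (l : K →ₗ[k] k) (p : MvPolynomial (Fin (N + 1)) K)
    (f : MvPolynomial (Fin (N + 1)) k) :
    coeffMap l (p * MvPolynomial.map (algebraMap k K) f) = coeffMap l p * f := by
  classical
  ext a
  simp only [coeff_coeffMap, coeff_mul, map_sum, coeff_map]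
  refine Finset.sum_congr rfl fun x _ => ?_
  rw [mul_comm, ← Algebra.smul_def, map_smul, smul_eq_mul, mul_comm]

theorem coeffMap_mul_X_pow (l : K →ₗ[k] k) (p : MvPolynomial (Fin (N + 1)) K)
    (i : Fin (N + 1)) (s : ℕ) : coeffMap l (p * X i ^ s) = coeffMap l p * X i ^ s := by
  simpa using coeffMap_mul_map l p (X i ^ s)

theorem isHomogeneous_coeffMap (l : K →ₗ[k] k) {p : MvPolynomial (Fin (N + 1)) K} {m : ℕ}
    (hp : p.IsHomogeneous m) : (coeffMap l p).IsHomogeneous m := by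
  intro a ha
  rw [coeff_coeffMap] at ha
  exact hp fun h => ha (by rw [h, map_zero])

theorem coeffMap_mem (l : K →ₗ[k] k) {I : Ideal (MvPolynomial (Fin (N + 1)) k)}
    {p : MvPolynomial (Fin (N + 1)) K} (hp : p ∈ I.map (MvPolynomial.map (algebraMap k K))) :
    coeffMap l p ∈ I := by
  rw [Ideal.map] at hp
  -- The functional is not linear over `K[x]`, hence the statement for all multiples of `p`.
  suffices h : ∀ c, coeffMap l (c * p) ∈ I by simpa using h 1
  induction hp using Submodule.span_induction with
  | mem x hx =>
    obtain ⟨f, hf, rfl⟩ := hx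
    intro c
    exact (coeffMap_mul_map l c f).symm ▸ I.mul_mem_left _ hf
  | zero =>
    intro c
    simp [coeffMap]
  | add x y _ _ hx hy =>
    intro c
    rw [mul_add, coeffMap_add]
    exact add_mem (hx c) (hy c)
  | smul a x _ hx =>
    intro c
    rw [smul_eq_mul, ← mul_assoc]
    exact hx _

theorem eq_sum_coeffMap {ι : Type*} [Fintype ι] (b : Module.Basis ι k K)
    (p : MvPolynomial (Fin (N + 1)) K) :
    p = ∑ j, C (b j) * MvPolynomial.map (algebraMap k K) (coeffMap (b.coord j) p) := by
  ext a
  simp only [coeff_sum, coeff_C_mul, coeff_map, coeff_coeffMap]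
  conv_lhs => rw [← b.sum_repr (p.coeff a)]
  refine Finset.sum_congr rfl fun j _ => ?_
  rw [Algebra.smul_def, mul_comm]
  rfl

/-- `x_{i₀}` is a nonzerodivisor on the homogeneous coordinate ring. -/
def IsRegularCoord (I : Ideal (MvPolynomial (Fin (N + 1)) k)) (i₀ : Fin (N + 1)) : Prop :=
  ∀ f, f * X i₀ ∈ I → f ∈ I

/-- In total degree `m + e ≥ m₀`, the product of `x_{i₀} ^ e` and a section of `O_X(m)`, given by
its restriction `P / x_{i₀} ^ r` to the chart `x_{i₀} ≠ 0`, is the class of a form. -/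
def FormsInDegree (I : Ideal (MvPolynomial (Fin (N + 1)) k)) (i₀ : Fin (N + 1)) (m₀ : ℕ) : Prop :=
  ∀ (m e r : ℕ) (P : MvPolynomial (Fin (N + 1)) k), m₀ ≤ m + e → P.IsHomogeneous (m + r) →
    (∀ i, ∃ s q, P * X i ^ s - q * X i₀ ^ r ∈ I) →
      ∃ g : MvPolynomial (Fin (N + 1)) k, g.IsHomogeneous (m + e) ∧
        X i₀ ^ e * P - X i₀ ^ r * g ∈ I

theorem IsRegularCoord.of_mul_pow {I : Ideal (MvPolynomial (Fin (N + 1)) k)} {i₀ : Fin (N + 1)}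
    (h : IsRegularCoord I i₀) (c : ℕ) {f} (hf : f * X i₀ ^ c ∈ I) : f ∈ I := by
  induction c with
  | zero => simpa using hf
  | succ c ih => exact ih (h _ (by rwa [pow_succ, ← mul_assoc] at hf))

theorem IsRegularCoord.map [FiniteDimensional k K] {I : Ideal (MvPolynomial (Fin (N + 1)) k)}
    {i₀ : Fin (N + 1)} (h : IsRegularCoord I i₀) :
    IsRegularCoord (I.map (MvPolynomial.map (algebraMap k K))) i₀ := by
  intro f hf
  rw [eq_sum_coeffMap (Module.finBasis k K) f]
  refine Ideal.sum_mem _ fun j _ => Ideal.mul_mem_left _ _ (Ideal.mem_map_of_mem _ (h _ ?_))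
  have := coeffMap_mem ((Module.finBasis k K).coord j)
    (show f * X i₀ ^ 1 ∈ I.map (MvPolynomial.map (algebraMap k K)) by rwa [pow_one])
  rwa [coeffMap_mul_X_pow, pow_one] at this

theorem FormsInDegree.map [FiniteDimensional k K] {I : Ideal (MvPolynomial (Fin (N + 1)) k)}
    {i₀ : Fin (N + 1)} {m₀ : ℕ} (h : FormsInDegree I i₀ m₀) :
    FormsInDegree (I.map (MvPolynomial.map (algebraMap k K))) i₀ m₀ := by
  intro m e r P hm hP hPq
  let b := Module.finBasis k K
  have hj : ∀ j, ∃ g : MvPolynomial (Fin (N + 1)) k, g.IsHomogeneous (m + e) ∧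
      X i₀ ^ e * coeffMap (b.coord j) P - X i₀ ^ r * g ∈ I := by
    intro j
    refine h m e r _ hm (isHomogeneous_coeffMap _ hP) fun i => ?_
    obtain ⟨s, q, hq⟩ := hPq i
    refine ⟨s, coeffMap (b.coord j) q, ?_⟩
    rw [← coeffMap_mul_X_pow, ← coeffMap_mul_X_pow, ← coeffMap_sub]
    exact coeffMap_mem _ hq
  choose g hg hgI using hj
  refine ⟨∑ j, C (b j) * MvPolynomial.map (algebraMap k K) (g j), ?_, ?_⟩
  · refine IsHomogeneous.sum _ _ _ fun j _ => ?_
    simpa using (isHomogeneous_C (Fin (N + 1)) (b j)).mul ((hg j).map (algebraMap k K))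
  · have : X i₀ ^ e * P - X i₀ ^ r * ∑ j, C (b j) * MvPolynomial.map (algebraMap k K) (g j) =
        ∑ j, C (b j) * MvPolynomial.map (algebraMap k K)
          (X i₀ ^ e * coeffMap (b.coord j) P - X i₀ ^ r * g j) := by
      conv_lhs => rw [eq_sum_coeffMap b P]
      rw [Finset.mul_sum, Finset.mul_sum, ← Finset.sum_sub_distrib]
      refine Finset.sum_congr rfl fun j _ => ?_
      simp only [map_sub, map_mul, map_pow, map_X]
      ring
    rw [this]
    exact Ideal.sum_mem _ fun j _ => Ideal.mul_mem_left _ _ (Ideal.mem_map_of_mem _ (hgI j))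

end Descent

/-! ### Global sections in terms of polynomials -/

section GlobalSectionsApi

variable {K : Type u} [Field K] {N : ℕ} {J : Ideal (MvPolynomial (Fin (N + 1)) K)}
  {i₀ : Fin (N + 1)} {m : ℕ}

/-- The section of `O_X(m)` defined by a form of degree `m`. -/
noncomputable def formSection (J : Ideal (MvPolynomial (Fin (N + 1)) K))
    (g : MvPolynomial (Fin (N + 1)) K) (hg : g.IsHomogeneous m) : GlobalSections J m :=
  ⟨fun i => algebraMap (CoordRing J) (Chart J i) (Ideal.Quotient.mk J g),
    fun i => ⟨0, g, hg, by rw [pow_zero, mul_one]⟩, fun i j => by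
      simp only [resLeft, resRight, IsLocalization.Away.awayToAwayLeft_eq,
        IsLocalization.Away.awayToAwayRight_eq]⟩

theorem algebraMap_chart_eq_iff (hJ : IsRegularCoord J i₀) {p q : MvPolynomial (Fin (N + 1)) K} :
    algebraMap (CoordRing J) (Chart J i₀) (Ideal.Quotient.mk J p) =
      algebraMap (CoordRing J) (Chart J i₀) (Ideal.Quotient.mk J q) ↔ p - q ∈ J := by
  constructor
  · intro h
    obtain ⟨⟨_, c, rfl⟩, hc⟩ := (IsLocalization.eq_iff_exists
      (Submonoid.powers (coordElt J i₀)) (Chart J i₀)).mp h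
    simp only [coordElt, ← map_pow, ← map_mul] at hc
    rw [Ideal.Quotient.eq] at hc
    refine hJ.of_mul_pow c ?_
    convert hc using 1
    ring
  · intro h
    rw [(Ideal.Quotient.eq).mpr h]

theorem isUnit_coordElt (J : Ideal (MvPolynomial (Fin (N + 1)) K)) (i : Fin (N + 1)) :
    IsUnit (algebraMap (CoordRing J) (Chart J i) (coordElt J i)) :=
  IsLocalization.Away.algebraMap_isUnit _

theorem exists_mul_pow_sub_mem (hJ : IsRegularCoord J i₀) {s : GlobalSections J m} {r t : ℕ}
    {P q : MvPolynomial (Fin (N + 1)) K} {i : Fin (N + 1)}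
    (hP : s.1 i₀ * algebraMap (CoordRing J) (Chart J i₀) (coordElt J i₀) ^ r =
      algebraMap (CoordRing J) (Chart J i₀) (Ideal.Quotient.mk J P))
    (hq : s.1 i * algebraMap (CoordRing J) (Chart J i) (coordElt J i) ^ t =
      algebraMap (CoordRing J) (Chart J i) (Ideal.Quotient.mk J q)) :
    ∃ c, (P * X i ^ t - q * X i₀ ^ r) * X i ^ c ∈ J := by
  have h1 := congrArg (resLeft J i₀ i) hP
  have h2 := congrArg (resRight J i₀ i) hq
  have h3 := s.2.2 i₀ i
  rw [map_mul, map_pow] at h1 h2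
  simp only [resLeft, resRight, IsLocalization.Away.awayToAwayLeft_eq,
    IsLocalization.Away.awayToAwayRight_eq] at h1 h2 h3
  have h4 : algebraMap (CoordRing J) (Overlap J i₀ i) (Ideal.Quotient.mk J (P * X i ^ t)) =
      algebraMap (CoordRing J) (Overlap J i₀ i) (Ideal.Quotient.mk J (q * X i₀ ^ r)) := by
    simp only [map_mul, map_pow, ← h1, ← h2, h3]
    simp only [coordElt]
    ring
  obtain ⟨⟨_, c, rfl⟩, hc⟩ := (IsLocalization.eq_iff_exists
    (Submonoid.powers (coordElt J i₀ * coordElt J i)) (Overlap J i₀ i)).mp h4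
  simp only [coordElt, ← map_pow, ← map_mul] at hc
  rw [Ideal.Quotient.eq] at hc
  refine ⟨c, hJ.of_mul_pow c ?_⟩
  convert hc using 1
  ring

/-- A section is determined by its restriction to a chart whose complement contains no associated
point of `X`. -/
theorem eq_zero_of_chart_eq_zero (hJ : IsRegularCoord J i₀) {s : GlobalSections J m}
    (hs : s.1 i₀ = 0) : s = 0 := by
  refine Subtype.ext (funext fun i => ?_)
  obtain ⟨t, q, -, hq⟩ := s.2.1 i
  obtain ⟨c, hc⟩ := exists_mul_pow_sub_mem hJ (s := s) (r := 0) (P := 0) (by simp [hs]) hq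
  have h1 : q * X i ^ c ∈ J := by simpa using hc
  have h2 : s.1 i * algebraMap (CoordRing J) (Chart J i) (coordElt J i) ^ (t + c) = 0 := by
    rw [pow_add, ← mul_assoc, hq]
    simp only [coordElt, ← map_pow, ← map_mul]
    rw [Ideal.Quotient.eq_zero_iff_mem.mpr h1, map_zero]
  exact ((isUnit_coordElt J i).pow _).mul_left_eq_zero.mp h2

theorem exists_form_eq (hJ : IsRegularCoord J i₀) {m₀ : ℕ} (hforms : FormsInDegree J i₀ m₀)
    (e : ℕ) (hm : m₀ ≤ m + e) (s : GlobalSections J m) :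
    ∃ g : MvPolynomial (Fin (N + 1)) K, g.IsHomogeneous (m + e) ∧
      s.1 i₀ * algebraMap (CoordRing J) (Chart J i₀) (coordElt J i₀) ^ e =
        algebraMap (CoordRing J) (Chart J i₀) (Ideal.Quotient.mk J g) := by
  obtain ⟨r, P, hP, hPs⟩ := s.2.1 i₀
  obtain ⟨g, hg, hgJ⟩ := hforms m e r P hm hP fun i => by
    obtain ⟨t, q, -, hq⟩ := s.2.1 i
    obtain ⟨c, hc⟩ := exists_mul_pow_sub_mem hJ hPs hq
    refine ⟨t + c, q * X i ^ c, ?_⟩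
    convert hc using 1
    ring
  refine ⟨g, hg, ?_⟩
  have h1 := (algebraMap_chart_eq_iff hJ).mpr hgJ
  refine ((isUnit_coordElt J i₀).pow r).mul_left_cancel ?_
  rw [map_mul, map_mul, ← hPs, map_mul, map_mul] at h1
  simp only [coordElt, map_pow] at h1 ⊢
  linear_combination h1

variable {C : Type*} [Field C] {σ : K →+* C}

theorem value_mul_pow (x : ConePoint J σ) {i : Fin (N + 1)} (hi : x.coords i ≠ 0)
    {s : GlobalSections J m} {r : ℕ} {p : MvPolynomial (Fin (N + 1)) K}
    (h : s.1 i * algebraMap (CoordRing J) (Chart J i) (coordElt J i) ^ r =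
      algebraMap (CoordRing J) (Chart J i) (Ideal.Quotient.mk J p)) :
    x.value m s * x.coords i ^ r = eval₂ σ x.coords p := by
  have he : ∀ a, x.evalChart i hi (algebraMap (CoordRing J) (Chart J i) a) = x.eval a := fun a => by
    rw [ConePoint.evalChart, Localization.awayLift, IsLocalization.Away.lift_eq]
  have := congrArg (x.evalChart i hi) h
  rw [map_mul, map_pow, he, he, x.eval_coordElt] at this
  rw [x.value_eq m s i hi, this]
  rfl

theorem value_smul (x : ConePoint J σ) (c : K) (s : GlobalSections J m) :
    x.value m (c • s) = σ c * x.value m s := by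
  obtain ⟨i, hi⟩ := x.exists_coord_ne_zero
  have he : ∀ a, x.evalChart i hi (algebraMap (CoordRing J) (Chart J i) a) = x.eval a := fun a => by
    rw [ConePoint.evalChart, Localization.awayLift, IsLocalization.Away.lift_eq]
  rw [x.value_eq m _ i hi, x.value_eq m _ i hi]
  change x.evalChart i hi (c • s.1 i) = _
  rw [smul_chart, map_mul, he]
  congr 1
  change eval₂ σ x.coords (MvPolynomial.C c) = σ c
  rw [eval₂_C]

theorem value_formSection (x : ConePoint J σ) {g : MvPolynomial (Fin (N + 1)) K}
    (hg : g.IsHomogeneous m) : x.value m (formSection J g hg) = eval₂ σ x.coords g := by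
  obtain ⟨i, hi⟩ := x.exists_coord_ne_zero
  have := value_mul_pow x hi (s := formSection J g hg) (r := 0) (p := g)
    (by rw [pow_zero, mul_one]; rfl)
  rwa [pow_zero, mul_one] at this

end GlobalSectionsApi

/-! ### Norms of sections and finite-dimensionality -/

section SectionBounds

variable {K : Type u} [Field K] {N : ℕ} {J : Ideal (MvPolynomial (Fin (N + 1)) K)}
  {i₀ : Fin (N + 1)} {m : ℕ}

/-- A bound for the numerators of a section over all charts bounds the section: at each point the
chart of the coordinate of largest norm is used. -/
theorem norm_value_le {C : Type*} [NormedField C] {σ : K →+* C} (x : ConePoint J σ)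
    {s : GlobalSections J m} {r : Fin (N + 1) → ℕ} {q : Fin (N + 1) → MvPolynomial (Fin (N + 1)) K}
    (hq : ∀ i, s.1 i * algebraMap (CoordRing J) (Chart J i) (coordElt J i) ^ r i =
      algebraMap (CoordRing J) (Chart J i) (Ideal.Quotient.mk J (q i))) {A : ℝ}
    (hA : ∀ i, ‖eval₂ σ x.coords (q i)‖ ≤ A * ‖x.coords‖ ^ (m + r i)) :
    ‖x.value m s‖ ≤ A * ‖x.coords‖ ^ m := by
  obtain ⟨i, hi⟩ := exists_norm_eq_norm_coord x.coords
  have hpos : 0 < ‖x.coords‖ := norm_pos_iff.mpr x.ne_zero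
  have h1 := value_mul_pow x (norm_pos_iff.mp (hi ▸ hpos)) (hq i)
  have h2 := hA i
  rw [← h1, norm_mul, norm_pow, ← hi, pow_add, ← mul_assoc] at h2
  exact le_of_mul_le_mul_right h2 (pow_pos hpos _)

variable [NumberField K]

theorem exists_norm_value_le_complex (s : GlobalSections J m) :
    ∃ A : ℝ, 1 ≤ A ∧ ∀ (σ : K →+* ℂ) (x : ConePoint J σ),
      ‖x.value m s‖ ≤ A * ‖x.coords‖ ^ m := by
  classical
  choose r q hqm hq using s.2.1
  obtain ⟨A, hA, h⟩ := exists_complex_bound (Finset.univ.image q)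
  refine ⟨A, hA, fun σ x => norm_value_le x hq fun i => ?_⟩
  refine (norm_eval₂_le_sum σ (hqm i) _).trans ?_
  gcongr
  exact h _ (Finset.mem_image_of_mem _ (Finset.mem_univ i)) σ

theorem exists_norm_value_le_padic (s : GlobalSections J m) :
    ∃ B : ℕ, 0 < B ∧ ∀ (p : ℕ) [Fact p.Prime] (σ : K →+* ℂ_[p]) (x : ConePoint J σ),
      ‖x.value m s‖ ≤ ‖(B : ℂ_[p])‖⁻¹ * ‖x.coords‖ ^ m := by
  classical
  choose r q hqm hq using s.2.1
  obtain ⟨B, hB, h⟩ := exists_padic_bound (Finset.univ.image q)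
  refine ⟨B, hB, fun p _ σ x => norm_value_le x hq fun i => ?_⟩
  exact norm_eval₂_le_of_ultrametric σ (hqm i) (by positivity)
    (h _ (Finset.mem_image_of_mem _ (Finset.mem_univ i)) p σ) _

end SectionBounds

section FiniteDimensional

variable {K : Type u} [Field K] {N : ℕ}

open Classical in
/-- The monomials with all exponents at most `m`. -/
noncomputable def boundedMonomials (K : Type u) [Field K] (N m : ℕ) :
    Finset (MvPolynomial (Fin (N + 1)) K) :=
  Finset.univ.image fun a : Fin (N + 1) → Fin (m + 1) =>
    monomial (Finsupp.equivFunOnFinite.symm fun i => (a i : ℕ)) 1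

theorem card_boundedMonomials_le (m : ℕ) :
    (boundedMonomials K N m).card ≤ (m + 1) ^ (N + 1) := by
  classical
  refine Finset.card_image_le.trans ?_
  simp

theorem mem_span_boundedMonomials {m : ℕ} {p : MvPolynomial (Fin (N + 1)) K}
    (hp : p.IsHomogeneous m) :
    p ∈ Submodule.span K (boundedMonomials K N m : Set (MvPolynomial (Fin (N + 1)) K)) := by
  classical
  refine mem_span_monomials hp fun a ha => Submodule.subset_span ?_
  rw [boundedMonomials, Finset.coe_image]
  refine ⟨fun i => ⟨a i, ?_⟩, by simp, ?_⟩
  · have := Finsupp.le_degree i a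
    omega
  · simp only
    congr 1
    ext i
    simp

/-- The `K`-linear map from polynomials to functions on the chart `x_i ≠ 0`. -/
noncomputable def toChart (J : Ideal (MvPolynomial (Fin (N + 1)) K)) (i : Fin (N + 1)) :
    MvPolynomial (Fin (N + 1)) K →ₗ[K] Chart J i :=
  ((IsScalarTower.toAlgHom K (CoordRing J) (Chart J i)).comp
    (Ideal.Quotient.mkₐ K J)).toLinearMap

variable {J : Ideal (MvPolynomial (Fin (N + 1)) K)} {i₀ : Fin (N + 1)}

theorem finite_globalSections (hJ : IsRegularCoord J i₀) {m₀ : ℕ} (hforms : FormsInDegree J i₀ m₀)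
    (m : ℕ) : Module.Finite K (GlobalSections J m) := by
  let f : GlobalSections J m →ₗ[K] Chart J i₀ :=
    (LinearMap.mulRight K (algebraMap (CoordRing J) (Chart J i₀) (coordElt J i₀) ^ m₀)) ∘ₗ
      (LinearMap.proj i₀) ∘ₗ (GlobalSections J m).subtype
  have hf : Function.Injective f := by
    rw [← LinearMap.ker_eq_bot, LinearMap.ker_eq_bot']
    intro s hs
    exact eq_zero_of_chart_eq_zero hJ (((isUnit_coordElt J i₀).pow m₀).mul_left_eq_zero.mp hs)
  have hr : LinearMap.range f ≤ (Submodule.span K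
      (boundedMonomials K N (m + m₀) : Set (MvPolynomial (Fin (N + 1)) K))).map
        (toChart J i₀) := by
    rintro _ ⟨s, rfl⟩
    obtain ⟨g, hg, hgs⟩ := exists_form_eq hJ hforms m₀ (by omega) s
    exact ⟨g, mem_span_boundedMonomials hg, hgs.symm⟩
  have : FiniteDimensional K (Submodule.span K
      (boundedMonomials K N (m + m₀) : Set (MvPolynomial (Fin (N + 1)) K))) :=
    FiniteDimensional.span_finset K _
  have := Submodule.finiteDimensional_of_le hr
  exact Module.Finite.equiv (LinearEquiv.ofInjective f hf).symm

end FiniteDimensional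

/-! ### Algebraic points in general position -/

section Points

variable {k : Type u} [Field k] [CharZero k] {N : ℕ} {I : Ideal (MvPolynomial (Fin (N + 1)) k)}

/-- Polynomials that are linearly independent over `k` modulo a prime ideal are linearly independent
over the algebraic closure as functions on its zero locus. The traces to `k` of a relation with
algebraic coefficients are relations over `k`, because the zero locus is stable under Galois
conjugation. -/
theorem eq_zero_of_forall_sum_mul_eq_zero [I.IsPrime] {ι : Type*} [Fintype ι]
    {p : ι → MvPolynomial (Fin (N + 1)) k}
    (hp : ∀ c : ι → k, ∑ i, C (c i) * p i ∈ I → c = 0) {c : ι → AlgebraicClosure k}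
    (hc : ∀ x ∈ zeroLocus (AlgebraicClosure k) I, ∑ i, c i * aeval x (p i) = 0) : c = 0 := by
  let Ω := AlgebraicClosure k
  let L : IntermediateField k Ω := IntermediateField.adjoin k (Set.range c)
  have : FiniteDimensional k L := IntermediateField.finiteDimensional_adjoin
    fun x _ => Algebra.IsIntegral.isIntegral x
  let b : ι → L := fun i => ⟨c i, IntermediateField.subset_adjoin k _ ⟨i, rfl⟩⟩
  have key : ∀ γ : L, (fun i => Algebra.trace k L (b i * γ)) = 0 := by
    intro γ
    refine hp _ ?_
    rw [← IsPrime.vanishingIdeal_zeroLocus (K := Ω) I]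
    intro x hx
    rw [map_sum]
    have h1 : ∀ i, aeval x (C (Algebra.trace k L (b i * γ)) * p i) =
        ∑ τ : L →ₐ[k] Ω, τ γ * (τ (b i) * aeval x (p i)) := by
      intro i
      rw [map_mul, aeval_C, trace_eq_sum_embeddings Ω, Finset.sum_mul]
      refine Finset.sum_congr rfl fun τ _ => ?_
      rw [map_mul]
      ring
    simp only [h1]
    rw [Finset.sum_comm]
    refine Finset.sum_eq_zero fun τ _ => ?_
    rw [← Finset.mul_sum]
    let τ' : Ω →ₐ[k] Ω := τ.liftNormal Ω
    have hτ : ∀ a : L, τ' (algebraMap L Ω a) = τ a := fun a => τ.liftNormal_commutes Ω a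
    obtain ⟨y, hy⟩ : ∃ y : Fin (N + 1) → Ω, ∀ j, τ' (y j) = x j :=
      ⟨_, fun j => ((Algebra.IsAlgebraic.algHom_bijective τ').2 (x j)).choose_spec⟩
    have hxy : ∀ q : MvPolynomial (Fin (N + 1)) k, aeval x q = τ' (aeval y q) := by
      intro q
      rw [← AlgHom.comp_apply, comp_aeval]
      simp only [hy]
    have hyI : y ∈ zeroLocus Ω I := by
      intro q hq
      have := hx q hq
      rw [hxy] at this
      exact (map_eq_zero τ').mp this
    have h2 := congrArg τ' (hc y hyI)
    rw [map_zero, map_sum] at h2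
    rw [show ∑ i, τ (b i) * aeval x (p i) = ∑ i, τ' (c i * aeval y (p i)) from
      Finset.sum_congr rfl fun i _ => by rw [map_mul, ← hxy, ← hτ]; rfl, h2, mul_zero]
  have hb : ∀ i, b i = 0 := fun i =>
    (traceForm_nondegenerate k L).1 (b i) fun γ => congrFun (key γ) i
  funext i
  exact congrArg (algebraMap L Ω) (hb i)

/-- Polynomials that are linearly independent modulo a prime ideal have an invertible matrix of
values at suitable algebraic points of the zero locus. -/
theorem exists_points_det_ne_zero [I.IsPrime] {r : ℕ} {p : Fin r → MvPolynomial (Fin (N + 1)) k}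
    (hp : ∀ c : Fin r → k, ∑ i, C (c i) * p i ∈ I → c = 0) :
    ∃ x : Fin r → Fin (N + 1) → AlgebraicClosure k,
      (∀ l, x l ∈ zeroLocus (AlgebraicClosure k) I) ∧
        IsUnit (Matrix.of fun l i => aeval (x l) (p i)) := by
  let Ω := AlgebraicClosure k
  let v : (Fin (N + 1) → Ω) → Fin r → Ω := fun x i => aeval x (p i)
  have hspan : Submodule.span Ω (v '' zeroLocus Ω I) = ⊤ := by
    by_contra hne
    obtain ⟨φ, hφ, hle⟩ := Submodule.exists_le_ker_of_lt_top _ (lt_top_iff_ne_top.mpr hne)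
    refine hφ ?_
    have h0 : (fun i => φ (Pi.single i 1)) = 0 := by
      refine eq_zero_of_forall_sum_mul_eq_zero hp fun x hx => ?_
      have h1 : φ (v x) = 0 := hle (Submodule.subset_span ⟨x, hx, rfl⟩)
      rw [LinearMap.pi_apply_eq_sum_univ] at h1
      rw [← h1]
      refine Finset.sum_congr rfl fun i _ => ?_
      rw [smul_eq_mul, mul_comm]
      congr 2
      funext j
      simp only [Pi.single_apply, eq_comm]
    refine LinearMap.pi_ext' fun i => LinearMap.ext_ring ?_
    exact congrFun h0 i
  obtain ⟨f, hf, -, hlin⟩ := Submodule.exists_fun_fin_finrank_span_eq Ω (v '' zeroLocus Ω I)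
  have hr : Module.finrank Ω (Submodule.span Ω (v '' zeroLocus Ω I)) = r := by
    rw [hspan, finrank_top, Module.finrank_fin_fun]
  choose x hx hxf using hf
  refine ⟨fun l => x (Fin.cast hr.symm l), fun l => hx _, ?_⟩
  rw [← Matrix.linearIndependent_rows_iff_isUnit]
  have h : (Matrix.of fun l i => aeval (x (Fin.cast hr.symm l)) (p i)).row =
      f ∘ Fin.cast hr.symm := funext fun l => hxf _
  rw [h]
  exact hlin.comp (Fin.cast hr.symm) (Fin.cast_injective _)

end Points

/-! ### Integrality and heights -/

section Integrality

theorem norm_coeff_prod_le_one {C : Type*} [NormedField C] [IsUltrametricDist C]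
    (s : Multiset C) (hs : ∀ z ∈ s, ‖z‖ ≤ 1) (i : ℕ) :
    ‖((s.map fun z => Polynomial.X - Polynomial.C z).prod).coeff i‖ ≤ 1 := by
  induction s using Multiset.induction_on generalizing i with
  | empty =>
    rw [Multiset.map_zero, Multiset.prod_zero, Polynomial.coeff_one]
    split_ifs <;> simp
  | cons z s ih =>
    have ih' := ih fun w hw => hs w (Multiset.mem_cons_of_mem hw)
    have hz := hs z (Multiset.mem_cons_self z s)
    rw [Multiset.map_cons, Multiset.prod_cons, sub_mul, Polynomial.coeff_sub,
      Polynomial.coeff_C_mul, sub_eq_add_neg]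
    refine (IsUltrametricDist.norm_add_le_max _ _).trans (max_le ?_ ?_)
    · cases i with
      | zero => simp
      | succ i => rw [Polynomial.coeff_X_mul]; exact ih' i
    · rw [norm_neg, norm_mul]
      exact mul_le_one₀ hz (norm_nonneg _) (ih' i)

/-- An element of a number field is integral if its absolute value is at most one under all
embeddings in all `ℂ_p`: the coefficients of its minimal polynomial are `p`-integral for all `p`. -/
theorem isIntegral_of_forall_norm_le_one {K : Type*} [Field K] [NumberField K] {z : K}
    (hz : ∀ (p : ℕ) [Fact p.Prime] (σ : K →+* ℂ_[p]), ‖σ z‖ ≤ 1) : IsIntegral ℤ z := by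
  have hint : IsIntegral ℚ z := Algebra.IsIntegral.isIntegral z
  have hcoeff : ∀ i, ∃ a : ℤ, (a : ℚ) = (minpoly ℚ z).coeff i := by
    intro i
    refine ⟨_, (Rat.den_eq_one_iff _).mp ?_⟩
    by_contra hne
    obtain ⟨p, hp, hpd⟩ := Nat.exists_prime_and_dvd hne
    have : Fact p.Prime := ⟨hp⟩
    have hsplit : ((minpoly ℚ z).map (algebraMap ℚ ℂ_[p])).Splits := IsAlgClosed.splits _
    have h1 := hsplit.eq_prod_roots_of_monic ((minpoly.monic hint).map _)
    have h2 := norm_coeff_prod_le_one ((minpoly ℚ z).map (algebraMap ℚ ℂ_[p])).roots (fun w hw => by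
      have hw' : w ∈ (minpoly ℚ z).rootSet ℂ_[p] := by
        rw [Polynomial.mem_rootSet']
        rw [Polynomial.mem_roots'] at hw
        exact ⟨hw.1, by simpa [Polynomial.IsRoot, Polynomial.eval_map_algebraMap] using hw.2⟩
      rw [← NumberField.Embeddings.range_eval_eq_rootSet_minpoly K ℂ_[p] z] at hw'
      obtain ⟨σ, rfl⟩ := hw'
      exact hz p σ) i
    rw [← h1, Polynomial.coeff_map] at h2
    have h3 : ‖(((minpoly ℚ z).coeff i : ℚ) : ℚ_[p])‖ ≤ 1 := by
      have e : algebraMap ℚ ℂ_[p] ((minpoly ℚ z).coeff i) =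
          algebraMap ℚ_[p] ℂ_[p] (((minpoly ℚ z).coeff i : ℚ) : ℚ_[p]) := by
        rw [eq_ratCast, map_ratCast]
      rw [e] at h2
      exact (PadicComplex.norm_extends' p _).ge.trans h2
    have h4 := PadicInt.isUnit_den _ h3
    rw [PadicInt.isUnit_iff] at h4
    have h5 : ‖(((minpoly ℚ z).coeff i).den : ℤ_[p])‖ < 1 :=
      PadicInt.norm_natCast_lt_one_iff.mpr hpd
    exact absurd h4 h5.ne
  have hlift : minpoly ℚ z ∈ Polynomial.lifts (algebraMap ℤ ℚ) := by
    rw [Polynomial.lifts_iff_coeff_lifts]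
    intro i
    obtain ⟨a, ha⟩ := hcoeff i
    exact ⟨a, ha⟩
  obtain ⟨q, hq, -, hqm⟩ :=
    Polynomial.lifts_and_natDegree_eq_and_monic hlift (minpoly.monic hint)
  refine ⟨q, hqm, ?_⟩
  have := minpoly.aeval ℚ z
  rw [← hq, Polynomial.aeval_map_algebraMap] at this
  exact this

end Integrality

section Heights

variable {K : Type*} [Field K] [NumberField K]

theorem norm_embedding_le_mulHeight₁ (σ : K →+* ℂ) (α : K) : ‖σ α‖ ≤ Height.mulHeight₁ α := by
  classical
  rw [NumberField.mulHeight₁_eq]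
  set v := NumberField.InfinitePlace.mk σ
  have hv : ‖σ α‖ = v α := rfl
  have h1 : max (v α) 1 ≤ ∏ w : NumberField.InfinitePlace K, max (w α) 1 ^ w.mult := by
    rw [← Finset.mul_prod_erase _ _ (Finset.mem_univ v)]
    have h2 : 1 ≤ ∏ w ∈ Finset.univ.erase v, max (w α) 1 ^ w.mult :=
      Finset.one_le_prod fun w _ => one_le_pow₀ (le_max_right _ _)
    have h3 : max (v α) 1 ≤ max (v α) 1 ^ v.mult :=
      le_self_pow₀ (le_max_right _ _) v.mult_ne_zero
    nlinarith [le_max_right (v α) 1]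
  have h4 : 1 ≤ ∏ᶠ w : NumberField.FinitePlace K, max (w α) 1 :=
    one_le_finprod fun w => le_max_right _ _
  rw [hv]
  nlinarith [le_max_left (v α) 1, le_max_right (v α) 1]

/-- A primitive element `α` gives a `ℚ`-basis of `K` by integral elements of size
`exp (O([K : ℚ] h(α)))` in each archimedean absolute value, where `h` is the height relative to
`K`: the powers of `α`, multiplied by a power of a denominator. -/
theorem exists_integral_basis_norm_le {α : K} (hα : IntermediateField.adjoin ℚ {α} = ⊤) :
    ∃ w : Module.Basis (Fin (Module.finrank ℚ K)) ℚ K, (∀ j, IsIntegral ℤ (w j)) ∧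
      ∀ j (σ : K →+* ℂ), ‖σ (w j)‖ ≤
        Real.exp (2 * Module.finrank ℚ K * Height.logHeight₁ α) := by
  obtain ⟨n, hn, hnH, hnα⟩ := NumberField.exists_nat_le_mulHeight₁ α
  set D := Module.finrank ℚ K
  have hint : IsIntegral ℚ α := Algebra.IsIntegral.isIntegral α
  let pb : PowerBasis ℚ K := PowerBasis.ofAdjoinEqTop hint (by
    rw [← IntermediateField.adjoin_simple_toSubalgebra_of_isAlgebraic hint.isAlgebraic, hα]
    rfl)
  have hgen : pb.gen = α := PowerBasis.ofAdjoinEqTop_gen _ _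
  have hdim : pb.dim = D := pb.finrank.symm
  have hnK : ((n : ℚ) ^ D) ≠ 0 := pow_ne_zero _ (by exact_mod_cast hn)
  let w : Module.Basis (Fin D) ℚ K :=
    (pb.basis.reindex (finCongr hdim)).unitsSMul fun _ => Units.mk0 ((n : ℚ) ^ D) hnK
  have hw : ∀ j, w j = (n : K) ^ D * α ^ (j : ℕ) := by
    intro j
    simp only [w, Module.Basis.unitsSMul_apply, Module.Basis.reindex_apply, pb.coe_basis, hgen]
    rw [Units.smul_def, Units.val_mk0, Algebra.smul_def]
    simp
  refine ⟨w, fun j => ?_, fun j σ => ?_⟩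
  · rw [hw, show (n : K) ^ D * α ^ (j : ℕ) = (n : K) ^ (D - j) * ((n : K) * α) ^ (j : ℕ) by
      rw [mul_pow, ← mul_assoc, ← pow_add, Nat.sub_add_cancel j.2.le]]
    exact ((isIntegral_natCast n).pow _).mul (hnα.pow _)
  · have h1 : 1 ≤ Height.mulHeight₁ α := Height.one_le_mulHeight₁ α
    rw [hw, map_mul, map_pow, map_pow, map_natCast, norm_mul, norm_pow, norm_pow,
      Complex.norm_natCast, Height.logHeight₁, mul_assoc, two_mul, ← Real.log_pow, Real.exp_add,
      Real.exp_log (by positivity)]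
    refine mul_le_mul (pow_le_pow_left₀ (by positivity) hnH _) ?_ (by positivity) (by positivity)
    exact (pow_le_pow_left₀ (norm_nonneg _) (norm_embedding_le_mulHeight₁ σ α) _).trans
      (pow_le_pow_right₀ h1 j.2.le)

end Heights

/-! ### Volumes of bodies and lattices that contain adapted boxes -/

section Volume

variable {R : ℕ} {ι ι' : Type*} [Fintype ι] [Finite ι']

theorem discreteTopology_of_le_span {L : Submodule ℤ (Fin R → ℝ)}
    (f : Module.Basis ι' ℝ (Fin R → ℝ)) (h : L ≤ Submodule.span ℤ (Set.range f)) :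
    DiscreteTopology L := by
  have : DiscreteTopology (Submodule.span ℤ (Set.range f)) := inferInstance
  exact DiscreteTopology.of_subset (s := (Submodule.span ℤ (Set.range f) : Set (Fin R → ℝ))) this h

theorem span_eq_top_of_basis_mem {κ : Type*} {L : Submodule ℤ (Fin R → ℝ)}
    (f : Module.Basis κ ℝ (Fin R → ℝ)) (h : ∀ i, f i ∈ L) :
    Submodule.span ℝ (L : Set (Fin R → ℝ)) = ⊤ := by
  rw [eq_top_iff, ← f.span_eq]
  refine Submodule.span_mono ?_
  rintro _ ⟨i, rfl⟩
  exact h i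

theorem covolume_le_of_basis_mem {L : Submodule ℤ (Fin R → ℝ)} [DiscreteTopology L]
    [IsZLattice ℝ L] (f : Module.Basis ι ℝ (Fin R → ℝ)) (h : ∀ i, f i ∈ L) :
    ZLattice.covolume L ≤ (volume (ZSpan.fundamentalDomain f)).toReal := by
  have hle : Submodule.span ℤ (Set.range f) ≤ L := by
    rw [Submodule.span_le]
    rintro _ ⟨i, rfl⟩
    exact h i
  have h1 := ZLattice.covolume_div_covolume_eq_relIndex _ _ hle
  have h2 : ZLattice.covolume (Submodule.span ℤ (Set.range f)) =
      (volume (ZSpan.fundamentalDomain f)).toReal :=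
    ZLattice.covolume_eq_measure_fundamentalDomain _ _ (ZSpan.isAddFundamentalDomain f volume)
  have hpos := ZLattice.covolume_pos L
  have hpos' := ZLattice.covolume_pos (Submodule.span ℤ (Set.range f))
  rw [← h2]
  rw [div_eq_iff hpos.ne'] at h1
  have h3 : 1 ≤ (Submodule.span ℤ (Set.range f)).toAddSubgroup.relIndex L.toAddSubgroup := by
    rw [Nat.one_le_iff_ne_zero]
    intro h0
    rw [h0, Nat.cast_zero, zero_mul] at h1
    exact hpos'.ne' h1
  rw [h1]
  exact le_mul_of_one_le_left hpos.le (by exact_mod_cast h3)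

open scoped Pointwise in
/-- A body that contains the box of half-width `ρ` in a basis has at least `(2 ρ) ^ R` times the
volume of the fundamental parallelepiped of that basis. -/
theorem volume_fundamentalDomain_le {S : Set (Fin R → ℝ)} (f : Module.Basis ι ℝ (Fin R → ℝ)) {ρ : ℝ}
    (hρ : 0 < ρ) (hS : ∀ t : ι → ℝ, (∀ i, |t i| ≤ ρ) → ∑ i, t i • f i ∈ S) :
    ENNReal.ofReal ((2 * ρ) ^ R) * volume (ZSpan.fundamentalDomain f) ≤ volume S := by
  have hsub : (-(ρ • ∑ i, f i)) +ᵥ ((2 * ρ) • ZSpan.fundamentalDomain f) ⊆ S := by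
    rintro _ ⟨_, ⟨v, hv, rfl⟩, rfl⟩
    rw [ZSpan.mem_fundamentalDomain] at hv
    have : -(ρ • ∑ i, f i) +ᵥ (2 * ρ) • v = ∑ i, (2 * ρ * f.repr v i - ρ) • f i := by
      conv_lhs => rw [← f.sum_repr v]
      simp only [vadd_eq_add, sub_smul, Finset.sum_sub_distrib, Finset.smul_sum, smul_smul]
      rw [neg_add_eq_sub]
    change -(ρ • ∑ i, f i) +ᵥ (2 * ρ) • v ∈ S
    rw [this]
    refine hS _ fun i => ?_
    obtain ⟨h0, h1⟩ := hv i
    rw [abs_le]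
    constructor <;> nlinarith
  refine le_trans (le_of_eq ?_) (measure_mono hsub)
  rw [measure_vadd, Measure.addHaar_smul, Module.finrank_fin_fun, abs_of_pos (by positivity)]

theorem volume_bound_of_box {L : Submodule ℤ (Fin R → ℝ)} {S : Set (Fin R → ℝ)}
    (f : Module.Basis ι ℝ (Fin R → ℝ)) (f' : Module.Basis ι' ℝ (Fin R → ℝ)) {ρ : ℝ} (hρ : 0 < ρ)
    (hf : ∀ i, f i ∈ L) (hf' : L ≤ Submodule.span ℤ (Set.range f'))
    (hS : ∀ t : ι → ℝ, (∀ i, |t i| ≤ ρ) → ∑ i, t i • f i ∈ S) (hSb : Bornology.IsBounded S) :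
    DiscreteTopology L ∧ Submodule.span ℝ (L : Set (Fin R → ℝ)) = ⊤ ∧
      volume S ≠ 0 ∧ volume S ≠ ⊤ ∧
      R * Real.log (2 * ρ) ≤ Real.log (volume S).toReal - Real.log (ZLattice.covolume L) := by
  have hd := discreteTopology_of_le_span f' hf'
  have hs := span_eq_top_of_basis_mem f hf
  have : IsZLattice ℝ L := ⟨hs⟩
  have htop : volume S ≠ ⊤ := hSb.measure_lt_top.ne
  have hcov := covolume_le_of_basis_mem f hf
  have hcpos := ZLattice.covolume_pos L
  have hvol := volume_fundamentalDomain_le f hρ hS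
  have hpos : 0 < (2 * ρ) ^ R := by positivity
  have hreal : (2 * ρ) ^ R * (volume (ZSpan.fundamentalDomain f)).toReal ≤ (volume S).toReal := by
    have := ENNReal.toReal_mono htop hvol
    rwa [ENNReal.toReal_mul, ENNReal.toReal_ofReal hpos.le] at this
  have hSpos : (2 * ρ) ^ R * ZLattice.covolume L ≤ (volume S).toReal :=
    (mul_le_mul_of_nonneg_left hcov hpos.le).trans hreal
  refine ⟨hd, hs, ?_, htop, ?_⟩
  · intro h0
    rw [h0, ENNReal.toReal_zero] at hSpos
    nlinarith [mul_pos hpos hcpos]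
  · have := Real.log_le_log (mul_pos hpos hcpos) hSpos
    rw [Real.log_mul hpos.ne' hcpos.ne', Real.log_pow] at this
    linarith

theorem isBounded_of_injective {S : Set (Fin R → ℝ)} {W : Type*} [NormedAddCommGroup W]
    [NormedSpace ℝ W] (Φ : (Fin R → ℝ) →ₗ[ℝ] W) (hΦ : Function.Injective Φ) {A : ℝ}
    (hS : ∀ s ∈ S, ‖Φ s‖ ≤ A) : Bornology.IsBounded S := by
  obtain ⟨K, -, hK⟩ := Φ.exists_antilipschitzWith (LinearMap.ker_eq_bot.mpr hΦ)
  refine (hK.isBounded_preimage (Metric.isBounded_closedBall (x := (0 : W)) (r := A))).subset ?_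
  intro s hs
  simpa using hS s hs

end Volume

/-! ### Interpolation at conjugates of algebraic points -/

section Interpolation

variable {k : Type u} [Field k] {K : Type u} [Field K] [Algebra k K] {N : ℕ}
  {I : Ideal (MvPolynomial (Fin (N + 1)) k)} {J : Ideal (MvPolynomial (Fin (N + 1)) K)}
  {i₀ : Fin (N + 1)} {m r e : ℕ}

theorem eval₂_map_conj {C : Type*} [Field C] {σ : K →+* C} (τ : AlgebraicClosure k →+* C)
    (hτ : ∀ a : k, τ (algebraMap k _ a) = σ (algebraMap k K a))
    (x : Fin (N + 1) → AlgebraicClosure k) (q : MvPolynomial (Fin (N + 1)) k) :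
    eval₂ σ (fun i => τ (x i)) (MvPolynomial.map (algebraMap k K) q) = τ (aeval x q) := by
  rw [eval₂_map, aeval_def, ← coe_eval₂Hom, ← coe_eval₂Hom, ← RingHom.comp_apply]
  congr 1
  refine ringHom_ext (fun a => ?_) fun i => ?_
  · simp [hτ]
  · simp

/-- The conjugate under `τ` of an algebraic point of the cone. -/
noncomputable def conjPoint (hJ : J = I.map (MvPolynomial.map (algebraMap k K))) {C : Type*}
    [Field C] {σ : K →+* C} (τ : AlgebraicClosure k →+* C)
    (hτ : ∀ a : k, τ (algebraMap k _ a) = σ (algebraMap k K a))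
    (x : Fin (N + 1) → AlgebraicClosure k) (hx : x ∈ zeroLocus (AlgebraicClosure k) I)
    (hx0 : x ≠ 0) : ConePoint J σ where
  coords := fun i => τ (x i)
  ne_zero := fun h => hx0 (funext fun i => (map_eq_zero τ).mp (congrFun h i))
  vanish := by
    intro p hp
    have hle : I.map (MvPolynomial.map (algebraMap k K)) ≤
        RingHom.ker (eval₂Hom σ fun i => τ (x i)) := by
      rw [Ideal.map_le_iff_le_comap]
      intro q hq
      rw [Ideal.mem_comap, RingHom.mem_ker, coe_eval₂Hom, eval₂_map_conj τ hτ, hx q hq, map_zero]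
    exact hle (hJ ▸ hp)

/-- Sections that are given by polynomials over `k`, linearly independent modulo the prime ideal
`I`, can be interpolated: there are finitely many algebraic points such that, for all embeddings,
the coefficients of a linear combination of these sections are fixed algebraic combinations of its
values at the conjugates of the points. -/
theorem exists_interpolation [CharZero k] [I.IsPrime] (hi₀ : X i₀ ∉ I)
    (hJ : J = I.map (MvPolynomial.map (algebraMap k K)))
    {p : Fin r → MvPolynomial (Fin (N + 1)) k}
    (hp : ∀ c : Fin r → k, ∑ i, C (c i) * p i ∈ I → c = 0) {b : Fin r → GlobalSections J m}
    (hb : ∀ i, (b i).1 i₀ * algebraMap (CoordRing J) (Chart J i₀) (coordElt J i₀) ^ e =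
      algebraMap (CoordRing J) (Chart J i₀)
        (Ideal.Quotient.mk J (MvPolynomial.map (algebraMap k K) (p i)))) :
    ∃ (x : Fin r → Fin (N + 1) → AlgebraicClosure k) (Q : Fin r → Fin r → AlgebraicClosure k),
      ∀ (C : Type) [Field C] (σ : K →+* C) (τ : AlgebraicClosure k →+* C),
        (∀ a : k, τ (algebraMap k _ a) = σ (algebraMap k K a)) →
        ∃ y : Fin r → ConePoint J σ, (∀ l, (y l).coords = fun i => τ (x l i)) ∧
          ∀ (z : Fin r → C) (i : Fin r), z i =
            ∑ l, τ (Q i l) * τ (x l i₀) ^ (e + 1) * ∑ j, z j * (y l).value m (b j) := by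
  -- The additional factor `x_{i₀}` forces the points to lie in the chart `x_{i₀} ≠ 0`.
  obtain ⟨x, hxI, hdet⟩ := exists_points_det_ne_zero (I := I) (p := fun i => X i₀ * p i)
    fun c hc => hp c (by
      have h1 : X i₀ * ∑ i, C (c i) * p i ∈ I := by
        rw [Finset.mul_sum]
        convert hc using 2
        ring
      exact (‹I.IsPrime›.mem_or_mem h1).resolve_left hi₀)
  set M : Matrix (Fin r) (Fin r) (AlgebraicClosure k) :=
    Matrix.of fun l i => aeval (x l) (X i₀ * p i) with hM
  have hMdet : IsUnit M.det := (Matrix.isUnit_iff_isUnit_det M).mp hdet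
  have hx0 : ∀ l, x l i₀ ≠ 0 := by
    intro l h
    refine hMdet.ne_zero (Matrix.det_eq_zero_of_row_eq_zero l fun i => ?_)
    simp [hM, h]
  obtain ⟨Q, hQ⟩ : ∃ Q : Matrix (Fin r) (Fin r) (AlgebraicClosure k), Q * M = 1 :=
    ⟨M⁻¹, Matrix.nonsing_inv_mul M hMdet⟩
  refine ⟨x, Q, fun C _ σ τ hτ => ?_⟩
  let y : Fin r → ConePoint J σ := fun l =>
    conjPoint hJ τ hτ (x l) (hxI l) fun h => hx0 l (congrFun h i₀)
  have hy : ∀ l, (y l).coords = fun i => τ (x l i) := fun l => rfl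
  refine ⟨y, hy, fun z i => ?_⟩
  have hval : ∀ l j, τ (x l i₀) ^ (e + 1) * (y l).value m (b j) = τ (M l j) := by
    intro l j
    have h1 := value_mul_pow (y l) (i := i₀) ((map_ne_zero τ).mpr (hx0 l)) (hb j)
    rw [hy, eval₂_map_conj τ hτ] at h1
    simp only [hM, Matrix.of_apply, map_mul, aeval_X, ← h1]
    ring
  have hQM : ∀ j, ∑ l, τ (Q i l) * τ (M l j) = if i = j then 1 else 0 := by
    intro j
    have h1 := congrFun (congrFun hQ i) j
    rw [Matrix.mul_apply, Matrix.one_apply] at h1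
    have h2 := congrArg τ h1
    rw [map_sum] at h2
    simp only [map_mul] at h2
    rw [h2]
    split_ifs <;> simp
  calc z i = ∑ j, z j * (if i = j then 1 else 0) := by simp
    _ = ∑ j, z j * ∑ l, τ (Q i l) * τ (M l j) := by simp only [hQM]
    _ = ∑ l, ∑ j, z j * (τ (Q i l) * τ (M l j)) := by
        simp only [Finset.mul_sum]
        exact Finset.sum_comm
    _ = _ := by
        refine Finset.sum_congr rfl fun l _ => ?_
        rw [Finset.mul_sum]
        refine Finset.sum_congr rfl fun j _ => ?_
        rw [← hval]
        ring

/-- Every embedding of `k` in an algebraically closed field extends to the algebraic closure. -/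
theorem exists_extension {C : Type*} [Field C] [IsAlgClosed C] (σ : K →+* C) :
    ∃ τ : AlgebraicClosure k →+* C, ∀ a : k, τ (algebraMap k _ a) = σ (algebraMap k K a) := by
  let : Algebra k C := (σ.comp (algebraMap k K)).toAlgebra
  let τ : AlgebraicClosure k →ₐ[k] C := IsAlgClosed.lift
  exact ⟨τ.toRingHom, fun a => τ.commutes a⟩

end Interpolation

/-! ### Bases of the real space of sections -/

section RealBasis

variable {K : Type u} [Field K] [NumberField K] {N : ℕ} {J : Ideal (MvPolynomial (Fin (N + 1)) K)}
  {d n r : ℕ} {ι : Type*}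

theorem realValue_tmul {σ : K →+* ℂ} (x : ConePoint J σ) (t : ℝ) (s : GlobalSections J (d ^ n)) :
    realValue x d n (t ⊗ₜ s) = t * x.value (d ^ n) s := by
  rw [realValue, LinearMap.liftBaseChange_tmul, Complex.real_smul]
  rfl

/-- The real basis of `V_n` formed by the products of the elements of a `ℚ`-basis of `K` and of a
`K`-basis of the space of sections. -/
noncomputable def realBasis (w : Module.Basis ι ℚ K)
    (b : Module.Basis (Fin r) K (GlobalSections J (d ^ n))) :
    Module.Basis (ι × Fin r) ℝ (RealSections J d n) :=
  (w.smulTower b).baseChange ℝ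

theorem realBasis_apply (w : Module.Basis ι ℚ K)
    (b : Module.Basis (Fin r) K (GlobalSections J (d ^ n))) (ji : ι × Fin r) :
    realBasis w b ji = 1 ⊗ₜ (w ji.1 • b ji.2) := by
  rw [realBasis, Module.Basis.baseChange_apply, Module.Basis.smulTower_apply]

theorem realValue_sum_realBasis [Fintype ι] {σ : K →+* ℂ} (x : ConePoint J σ)
    (w : Module.Basis ι ℚ K) (b : Module.Basis (Fin r) K (GlobalSections J (d ^ n)))
    (t : ι × Fin r → ℝ) :
    realValue x d n (∑ ji, t ji • realBasis w b ji) =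
      ∑ ji, t ji * (σ (w ji.1) * x.value (d ^ n) (b ji.2)) := by
  rw [map_sum]
  refine Finset.sum_congr rfl fun ji _ => ?_
  rw [map_smul, realBasis_apply, realValue_tmul, value_smul, Complex.real_smul, Complex.ofReal_one,
    one_mul]

end RealBasis

/-! ### Comparison of the lattice and the unit ball with boxes -/

theorem value_sum {K : Type u} [Field K] {N : ℕ} {J : Ideal (MvPolynomial (Fin (N + 1)) K)}
    {C : Type*} [Field C] {σ : K →+* C} {m r : ℕ} (x : ConePoint J σ)
    (b : Fin r → GlobalSections J m) (z : Fin r → K) :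
    x.value m (∑ j, z j • b j) = ∑ j, σ (z j) * x.value m (b j) := by
  rw [map_sum]
  simp only [value_smul]

section Comparison

variable {k : Type u} [Field k] [NumberField k] {K : Type u} [Field K] [NumberField K]
  [Algebra k K] {N : ℕ} {I : Ideal (MvPolynomial (Fin (N + 1)) k)}
  {J : Ideal (MvPolynomial (Fin (N + 1)) K)} {F : Fin (N + 1) → MvPolynomial (Fin (N + 1)) k}
  {i₀ : Fin (N + 1)} {d n r e : ℕ} {p : Fin r → MvPolynomial (Fin (N + 1)) k}

theorem linearIndependent_of_forms [I.IsPrime] (hi₀ : X i₀ ∉ I)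
    (hJ : J = I.map (MvPolynomial.map (algebraMap k K)))
    (hp : ∀ c : Fin r → k, ∑ i, C (c i) * p i ∈ I → c = 0) {m : ℕ}
    {b : Fin r → GlobalSections J m}
    (hb : ∀ i, (b i).1 i₀ * algebraMap (CoordRing J) (Chart J i₀) (coordElt J i₀) ^ e =
      algebraMap (CoordRing J) (Chart J i₀)
        (Ideal.Quotient.mk J (MvPolynomial.map (algebraMap k K) (p i)))) :
    LinearIndependent K b := by
  rw [Fintype.linearIndependent_iff]
  intro c hc i
  obtain ⟨x, Q, hint⟩ := exists_interpolation hi₀ hJ hp hb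
  obtain ⟨σ⟩ : Nonempty (K →+* ℂ) := inferInstance
  obtain ⟨τ, hτ⟩ := exists_extension (k := k) σ
  obtain ⟨y, -, hy⟩ := hint ℂ σ τ hτ
  have h := hy (fun j => σ (c j)) i
  simp only [← value_sum, hc, map_zero, mul_zero, Finset.sum_const_zero] at h
  exact (map_eq_zero σ).mp h

/-- The coefficients of the elements of `M_n` in a basis of sections have bounded denominators. -/
theorem exists_isIntegral_mul_repr [I.IsPrime] (hi₀ : X i₀ ∉ I) (hd : 2 ≤ d)
    (hJ : J = I.map (MvPolynomial.map (algebraMap k K))) {B : ℕ} (hB : 0 < B)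
    (hgrowth : ∀ (p : ℕ) [Fact p.Prime] (σ : k →+* ℂ_[p]), NormGrowth F d σ ‖(B : ℂ_[p])‖⁻¹)
    (hp : ∀ c : Fin r → k, ∑ i, C (c i) * p i ∈ I → c = 0)
    (b : Module.Basis (Fin r) K (GlobalSections J (d ^ n)))
    (hb : ∀ i, (b i).1 i₀ * algebraMap (CoordRing J) (Chart J i₀) (coordElt J i₀) ^ e =
      algebraMap (CoordRing J) (Chart J i₀)
        (Ideal.Quotient.mk J (MvPolynomial.map (algebraMap k K) (p i)))) :
    ∃ Q₀ : ℕ, 0 < Q₀ ∧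
      ∀ s ∈ integralSections J (fun i => MvPolynomial.map (algebraMap k K) (F i)) d n,
        ∀ i, IsIntegral ℤ ((Q₀ : K) * b.repr s i) := by
  classical
  obtain ⟨x, Q, hint⟩ := exists_interpolation hi₀ hJ hp hb
  have : Algebra.IsAlgebraic ℚ (AlgebraicClosure k) := Algebra.IsAlgebraic.trans ℚ k _
  obtain ⟨A, hA, hAs⟩ := exists_nat_norm_le_inv
    ((Finset.univ.image fun il : Fin r × Fin r => Q il.1 il.2) ∪
      Finset.univ.image fun lj : Fin r × Fin (N + 1) => x lj.1 lj.2)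
  -- One factor `A` for `Q`, `e + 1` for `x_{i₀}`, and `(B A) ^ m` for the value of the section.
  refine ⟨A ^ (e + 2) * (B * A) ^ d ^ n, by positivity, fun s hs i => ?_⟩
  refine isIntegral_of_forall_norm_le_one fun q _ σ => ?_
  obtain ⟨τ, hτ⟩ := exists_extension (k := k) σ
  obtain ⟨y, hyx, hy⟩ := hint ℂ_[q] σ τ hτ
  have hA0 : (0 : ℝ) < ‖(A : ℂ_[q])‖ := norm_pos_iff.mpr (by exact_mod_cast hA.ne')
  have hB0 : (0 : ℝ) < ‖(B : ℂ_[q])‖ := norm_pos_iff.mpr (by exact_mod_cast hB.ne')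
  have hQ : ∀ l, ‖τ (Q i l)‖ ≤ ‖(A : ℂ_[q])‖⁻¹ := fun l => hAs _ (Finset.mem_union_left _
    (Finset.mem_image_of_mem (fun il : Fin r × Fin r => Q il.1 il.2)
      (Finset.mem_univ (i, l)))) q τ
  have hx : ∀ l j, ‖τ (x l j)‖ ≤ ‖(A : ℂ_[q])‖⁻¹ := fun l j => hAs _ (Finset.mem_union_right _
    (Finset.mem_image_of_mem (fun lj : Fin r × Fin (N + 1) => x lj.1 lj.2)
      (Finset.mem_univ (l, j)))) q τ
  have hval : ∀ l, ‖(y l).value (d ^ n) s‖ ≤ (‖(B : ℂ_[q])‖⁻¹ * ‖(A : ℂ_[q])‖⁻¹) ^ d ^ n := by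
    intro l
    have h1 := hs q σ (y l)
    rw [Real.exp_neg, mul_inv_le_iff₀ (Real.exp_pos _), one_mul, green_map] at h1
    refine h1.trans ?_
    rw [← Nat.cast_pow, Real.exp_nat_mul]
    refine pow_le_pow_left₀ (Real.exp_pos _).le ?_ _
    refine ((hgrowth q (σ.comp (algebraMap k K))).exp_green_le hd (y l).ne_zero).trans ?_
    refine mul_le_mul_of_nonneg_left ?_ (by positivity)
    rw [pi_norm_le_iff_of_nonneg (by positivity), hyx]
    exact hx l
  have hz : ‖σ (b.repr s i)‖ ≤ ‖(A : ℂ_[q])‖⁻¹ ^ (e + 2) *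
      (‖(B : ℂ_[q])‖⁻¹ * ‖(A : ℂ_[q])‖⁻¹) ^ d ^ n := by
    rw [hy (fun j => σ (b.repr s j)) i]
    refine IsUltrametricDist.norm_sum_le_of_forall_le_of_nonneg (by positivity) fun l _ => ?_
    rw [← value_sum, b.sum_repr, norm_mul, norm_mul, norm_pow, pow_succ' _ (e + 1)]
    gcongr
    exacts [hQ l, hx l i₀, hval l]
  have hcast : ((A ^ (e + 2) * (B * A) ^ d ^ n : ℕ) : K) * b.repr s i =
      (A : K) ^ (e + 2) * ((B : K) * A) ^ d ^ n * b.repr s i := by push_cast; ring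
  rw [hcast, map_mul, map_mul, map_pow, map_pow, map_mul, map_natCast, map_natCast, norm_mul,
    norm_mul, norm_pow, norm_pow, norm_mul]
  refine (mul_le_mul_of_nonneg_left hz (by positivity)).trans (le_of_eq ?_)
  rw [← mul_inv, mul_mul_mul_comm, ← mul_pow, ← mul_pow, mul_inv_cancel₀ hA0.ne',
    mul_inv_cancel₀ (mul_pos hB0 hA0).ne', one_pow, one_pow, one_mul]

/-- If the coefficients of the elements of `M_n` in a basis of sections have bounded
denominators, then `M_n` is contained in a lattice. -/
theorem exists_basis_coordLattice_le {F' : Fin (N + 1) → MvPolynomial (Fin (N + 1)) K}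
    (b : Module.Basis (Fin r) K (GlobalSections J (d ^ n))) {Q₀ : ℕ} (hQ₀ : 0 < Q₀)
    (hint : ∀ s ∈ integralSections J F' d n, ∀ i, IsIntegral ℤ ((Q₀ : K) * b.repr s i)) :
    ∃ w : Module.Basis (Module.Free.ChooseBasisIndex ℤ (NumberField.RingOfIntegers K)) ℚ K,
      ∀ {R : ℕ} (E : RealSections J d n ≃ₗ[ℝ] (Fin R → ℝ)),
        coordLattice J F' d n E ≤ Submodule.span ℤ (Set.range ((realBasis w b).map E)) := by
  have hQ : (Q₀ : ℚ) ≠ 0 := by exact_mod_cast hQ₀.ne'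
  refine ⟨(NumberField.integralBasis K).unitsSMul fun _ => (Units.mk0 (Q₀ : ℚ) hQ)⁻¹,
    fun E => ?_⟩
  rintro _ ⟨s, hs, rfl⟩
  rw [Module.Basis.mem_span_iff_repr_mem]
  rintro ⟨j, i⟩
  obtain ⟨a, ha⟩ : ∃ a : NumberField.RingOfIntegers K,
      algebraMap (NumberField.RingOfIntegers K) K a = (Q₀ : K) * b.repr s i :=
    ⟨⟨_, hint s hs i⟩, rfl⟩
  have h1 := NumberField.integralBasis_repr_apply K a j
  rw [ha] at h1
  refine ⟨(NumberField.RingOfIntegers.basis K).repr a j, ?_⟩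
  have h2 : ((realBasis ((NumberField.integralBasis K).unitsSMul
      fun _ => (Units.mk0 (Q₀ : ℚ) hQ)⁻¹) b).map E).repr (E (1 ⊗ₜ s)) (j, i) =
      (((NumberField.integralBasis K).repr ((Q₀ : K) * b.repr s i) j : ℚ) : ℝ) := by
    rw [Module.Basis.map_repr, LinearEquiv.trans_apply, LinearEquiv.symm_apply_apply, realBasis,
      Module.Basis.baseChange_repr_tmul, Module.Basis.smulTower_repr,
      Module.Basis.repr_unitsSMul, inv_inv]
    rw [show (Q₀ : K) * b.repr s i = (Q₀ : ℚ) • b.repr s i by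
      rw [Algebra.smul_def, eq_ratCast, Rat.cast_natCast]]
    rw [map_smul, Finsupp.smul_apply, Units.smul_def, Units.val_mk0]
    simp [Algebra.smul_def]
  refine Eq.trans ?_ h2.symm
  rw [h1]
  simp

theorem isBounded_coordBall [I.IsPrime] (hi₀ : X i₀ ∉ I)
    (hJ : J = I.map (MvPolynomial.map (algebraMap k K)))
    {F' : Fin (N + 1) → MvPolynomial (Fin (N + 1)) K}
    (hp : ∀ c : Fin r → k, ∑ i, C (c i) * p i ∈ I → c = 0)
    (b : Module.Basis (Fin r) K (GlobalSections J (d ^ n)))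
    (hb : ∀ i, (b i).1 i₀ * algebraMap (CoordRing J) (Chart J i₀) (coordElt J i₀) ^ e =
      algebraMap (CoordRing J) (Chart J i₀)
        (Ideal.Quotient.mk J (MvPolynomial.map (algebraMap k K) (p i))))
    {R : ℕ} (E : RealSections J d n ≃ₗ[ℝ] (Fin R → ℝ)) :
    Bornology.IsBounded (coordBall J F' d n E) := by
  obtain ⟨x, Q, hint⟩ := exists_interpolation hi₀ hJ hp hb
  choose τ hτ using fun σ : K →+* ℂ => exists_extension (k := k) σ
  choose y hyx hy using fun σ : K →+* ℂ => hint ℂ σ (τ σ) (hτ σ)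
  let Φ : (Fin R → ℝ) →ₗ[ℝ] ((K →+* ℂ) × Fin r → ℂ) :=
    LinearMap.pi fun a => realValue (y a.1 a.2) d n ∘ₗ E.symm.toLinearMap
  refine isBounded_of_injective Φ ?_
    (A := ∑ a : (K →+* ℂ) × Fin r, Real.exp ((d : ℝ) ^ n * green F' d a.1 (y a.1 a.2).coords)) ?_
  · rw [← LinearMap.ker_eq_bot, LinearMap.ker_eq_bot']
    intro v hv
    let w := NumberField.integralBasis K
    have hrepr := (realBasis w b).sum_repr (E.symm v)
    set t := (realBasis w b).repr (E.symm v)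
    -- The values at the interpolation points determine the coefficients of the sections `b i`
    -- under each embedding, and an element of `K ⊗ ℝ` is determined by its images in `ℂ`.
    have h0 : ∀ (σ : K →+* ℂ) i, ∑ j, ((t (j, i) : ℝ) : ℂ) * σ (w j) = 0 := by
      intro σ i
      have h1 := hy σ (fun i => ∑ j, ((t (j, i) : ℝ) : ℂ) * σ (w j)) i
      refine h1.trans (Finset.sum_eq_zero fun l _ => ?_)
      have h2 : realValue (y σ l) d n (E.symm v) = 0 := congrFun hv (σ, l)
      rw [← hrepr, realValue_sum_realBasis, Fintype.sum_prod_type_right] at h2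
      have h3 : ∑ i, (∑ j, ((t (j, i) : ℝ) : ℂ) * σ (w j)) * (y σ l).value (d ^ n) (b i) = 0 := by
        rw [← h2]
        refine Finset.sum_congr rfl fun i _ => ?_
        rw [Finset.sum_mul]
        exact Finset.sum_congr rfl fun j _ => mul_assoc _ _ _
      rw [h3, mul_zero]
    have ht : ∀ j i, t (j, i) = 0 := by
      intro j i
      have hli := (NumberField.canonicalEmbedding.latticeBasis K).linearIndependent
      rw [Fintype.linearIndependent_iff] at hli
      have := hli (fun j => ((t (j, i) : ℝ) : ℂ)) (by
        funext σ
        rw [Finset.sum_apply, Pi.zero_apply, ← h0 σ i]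
        refine Finset.sum_congr rfl fun j _ => ?_
        rw [NumberField.canonicalEmbedding.latticeBasis_apply]
        rfl) j
      exact_mod_cast this
    have : E.symm v = 0 := by
      rw [← hrepr]
      exact Finset.sum_eq_zero fun ji _ => by rw [ht ji.1 ji.2, zero_smul]
    simpa using this
  · rintro _ ⟨s, hs, rfl⟩
    rw [pi_norm_le_iff_of_nonneg (Finset.sum_nonneg fun a _ => (Real.exp_pos _).le)]
    intro a
    have h1 := hs a.1 (y a.1 a.2)
    rw [Real.exp_neg, mul_inv_le_iff₀ (Real.exp_pos _), one_mul] at h1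
    have h2 : Φ (E s) a = realValue (y a.1 a.2) d n s := by simp [Φ]
    rw [h2]
    exact h1.trans (Finset.single_le_sum
      (f := fun a : (K →+* ℂ) × Fin r =>
        Real.exp ((d : ℝ) ^ n * green F' d a.1 (y a.1 a.2).coords))
      (fun a _ => (Real.exp_pos _).le) (Finset.mem_univ a))

theorem realBasis_map_mem_coordLattice {F' : Fin (N + 1) → MvPolynomial (Fin (N + 1)) K}
    {ι : Type*} (w : Module.Basis ι ℚ K) (b : Module.Basis (Fin r) K (GlobalSections J (d ^ n)))
    (hw : ∀ (q : ℕ) [Fact q.Prime] (σ : K →+* ℂ_[q]) (x : ConePoint J σ) j i,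
      ‖σ (w j)‖ * ‖x.value (d ^ n) (b i)‖ ≤ Real.exp ((d : ℝ) ^ n * green F' d σ x.coords))
    {R : ℕ} (E : RealSections J d n ≃ₗ[ℝ] (Fin R → ℝ)) (ji : ι × Fin r) :
    (realBasis w b).map E ji ∈ coordLattice J F' d n E := by
  refine ⟨w ji.1 • b ji.2, fun q _ σ x => ?_, ?_⟩
  · rw [Real.exp_neg, mul_inv_le_iff₀ (Real.exp_pos _), one_mul, value_smul, norm_mul]
    exact hw q σ x ji.1 ji.2
  · rw [Module.Basis.map_apply, realBasis_apply]
    rfl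

theorem sum_smul_realBasis_mem_coordBall {F' : Fin (N + 1) → MvPolynomial (Fin (N + 1)) K}
    {ι : Type*} [Fintype ι] (w : Module.Basis ι ℚ K)
    (b : Module.Basis (Fin r) K (GlobalSections J (d ^ n))) {T ρ : ℝ} (hρ : 0 ≤ ρ)
    (hw : ∀ (σ : K →+* ℂ) (x : ConePoint J σ) j i, ‖σ (w j)‖ * ‖x.value (d ^ n) (b i)‖ ≤
      T * Real.exp ((d : ℝ) ^ n * green F' d σ x.coords))
    (hT : Fintype.card ι * r * (ρ * T) ≤ 1)
    {R : ℕ} (E : RealSections J d n ≃ₗ[ℝ] (Fin R → ℝ)) {t : ι × Fin r → ℝ} (ht : ∀ i, |t i| ≤ ρ) :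
    ∑ i, t i • (realBasis w b).map E i ∈ coordBall J F' d n E := by
  refine ⟨∑ i, t i • realBasis w b i, fun σ x => ?_, ?_⟩
  · rw [Real.exp_neg, mul_inv_le_iff₀ (Real.exp_pos _), one_mul, realValue_sum_realBasis]
    have hterm : ∀ ji ∈ (Finset.univ : Finset (ι × Fin r)),
        ‖(t ji : ℂ) * (σ (w ji.1) * x.value (d ^ n) (b ji.2))‖ ≤
          ρ * (T * Real.exp ((d : ℝ) ^ n * green F' d σ x.coords)) := by
      intro ji _
      rw [norm_mul, norm_mul, Complex.norm_real, Real.norm_eq_abs]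
      exact mul_le_mul (ht ji) (hw σ x ji.1 ji.2) (by positivity) hρ
    refine (norm_sum_le_of_le _ hterm).trans ?_
    rw [Finset.sum_const, nsmul_eq_mul, Finset.card_univ, Fintype.card_prod, Fintype.card_fin,
      Nat.cast_mul, ← mul_assoc ρ, ← mul_assoc]
    exact mul_le_of_le_one_left (Real.exp_pos _).le hT
  · rw [map_sum]
    simp only [map_smul, Module.Basis.map_apply]

/-- A basis of sections and a basis of `K` with bounded absolute values give a bound for the
volumes. -/
theorem volumeBound_of_basis [I.IsPrime] (hi₀ : X i₀ ∉ I) (hd : 2 ≤ d)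
    (hJ : J = I.map (MvPolynomial.map (algebraMap k K))) {B : ℕ} (hB : 0 < B)
    (hgrowth : ∀ (p : ℕ) [Fact p.Prime] (σ : k →+* ℂ_[p]), NormGrowth F d σ ‖(B : ℂ_[p])‖⁻¹)
    (hp : ∀ c : Fin r → k, ∑ i, C (c i) * p i ∈ I → c = 0)
    {b : Fin r → GlobalSections J (d ^ n)} (hspan : ⊤ ≤ Submodule.span K (Set.range b))
    (hb : ∀ i, (b i).1 i₀ * algebraMap (CoordRing J) (Chart J i₀) (coordElt J i₀) ^ e =
      algebraMap (CoordRing J) (Chart J i₀)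
        (Ideal.Quotient.mk J (MvPolynomial.map (algebraMap k K) (p i))))
    {F' : Fin (N + 1) → MvPolynomial (Fin (N + 1)) K}
    (hF' : F' = fun i => MvPolynomial.map (algebraMap k K) (F i))
    {ι : Type*} [Fintype ι] (w : Module.Basis ι ℚ K)
    (hw : ∀ (q : ℕ) [Fact q.Prime] (σ : K →+* ℂ_[q]) (x : ConePoint J σ) j i,
      ‖σ (w j)‖ * ‖x.value (d ^ n) (b i)‖ ≤ Real.exp ((d : ℝ) ^ n * green F' d σ x.coords))
    {T ρ : ℝ} (hρ : 0 < ρ)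
    (hw' : ∀ (σ : K →+* ℂ) (x : ConePoint J σ) j i, ‖σ (w j)‖ * ‖x.value (d ^ n) (b i)‖ ≤
      T * Real.exp ((d : ℝ) ^ n * green F' d σ x.coords))
    (hT : Module.finrank ℚ K * r * (ρ * T) ≤ 1) {α : K} {c : ℝ}
    (hc0 : 0 ≤ c * ((d : ℝ) ^ ((n : ℝ) / 2) +
        (Module.finrank ℚ K : ℝ) ^ 2 * (Height.logHeight₁ α / Module.finrank ℚ K)))
    (hc : -Real.log (2 * ρ) ≤ c * ((d : ℝ) ^ ((n : ℝ) / 2) +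
        (Module.finrank ℚ K : ℝ) ^ 2 * (Height.logHeight₁ α / Module.finrank ℚ K))) :
    VolumeBound J F' d n α c := by
  let b' := Module.Basis.mk (linearIndependent_of_forms hi₀ hJ hp hb) hspan
  have hb' : ∀ i, b' i = b i := fun i => Module.Basis.mk_apply _ _ i
  have hT' : (Fintype.card ι : ℝ) * r * (ρ * T) ≤ 1 := by
    rwa [← Module.finrank_eq_card_basis w]
  simp only [← hb'] at hb hw hw'
  refine ⟨Module.Finite.of_basis (realBasis w b'), fun E => ?_⟩
  obtain ⟨Q₀, hQ₀, hint⟩ := exists_isIntegral_mul_repr hi₀ hd hJ hB hgrowth hp b' hb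
  rw [← hF'] at hint
  obtain ⟨w₀, hw₀⟩ := exists_basis_coordLattice_le b' hQ₀ hint
  obtain ⟨h1, h2, h3, h4, h5⟩ := volume_bound_of_box ((realBasis w b').map E)
    ((realBasis w₀ b').map E) hρ (realBasis_map_mem_coordLattice w b' hw E) (hw₀ E)
    (fun t ht => sum_smul_realBasis_mem_coordBall w b' hρ.le hw' hT' E ht)
    (isBounded_coordBall hi₀ hJ (F' := F') hp b' hb E)
  refine ⟨h1, h2, h3, h4, ?_⟩
  rw [neg_mul]
  rcases Nat.eq_zero_or_pos (Module.finrank ℝ (RealSections J d n)) with h0 | h0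
  · -- For `V_n = 0` the right-hand side has the value `0`.
    rw [show (Module.finrank ℝ (RealSections J d n) : ℝ) = 0 by exact_mod_cast h0]
    simpa using hc0
  · have h0' : (0 : ℝ) < Module.finrank ℝ (RealSections J d n) := by exact_mod_cast h0
    rw [one_div, ← div_eq_inv_mul, le_div_iff₀ h0']
    nlinarith

end Comparison

/-! ### Sections given by forms with small norms -/

section SmallSections

variable {k : Type u} [Field k] {N : ℕ} {I : Ideal (MvPolynomial (Fin (N + 1)) k)}

/-- A spanning set of the forms of degree `m` contains a basis of the forms of degree `m` modulo
`I`. -/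
theorem exists_forms_basis {m : ℕ} {S : Set (MvPolynomial (Fin (N + 1)) k)}
    (hSm : ∀ q ∈ S, q.IsHomogeneous m)
    (hS : ∀ q : MvPolynomial (Fin (N + 1)) k, q.IsHomogeneous m → q ∈ Submodule.span k S) :
    ∃ (r : ℕ) (p : Fin r → MvPolynomial (Fin (N + 1)) k), r ≤ (m + 1) ^ (N + 1) ∧
      (∀ i, p i ∈ S) ∧ (∀ c : Fin r → k, ∑ i, C (c i) * p i ∈ I → c = 0) ∧
      ∀ g : MvPolynomial (Fin (N + 1)) k, g.IsHomogeneous m →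
        ∃ c : Fin r → k, g - ∑ i, C (c i) * p i ∈ I := by
  classical
  let π : MvPolynomial (Fin (N + 1)) k →ₗ[k] CoordRing I :=
    (Ideal.Quotient.mkₐ k I).toLinearMap
  have hπ : ∀ q, π q = 0 ↔ q ∈ I := fun q => Ideal.Quotient.eq_zero_iff_mem
  have hle : Submodule.span k (π '' S) ≤
      Submodule.span k (((boundedMonomials k N m).image π : Finset _) : Set (CoordRing I)) := by
    rw [Finset.coe_image, Submodule.span_le, Submodule.span_image]
    rintro _ ⟨q, hq, rfl⟩
    exact Submodule.mem_map_of_mem (mem_span_boundedMonomials (hSm q hq))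
  have := FiniteDimensional.span_finset k ((boundedMonomials k N m).image π)
  have := Submodule.finiteDimensional_of_le hle
  obtain ⟨f, hfS, hspan, hli⟩ := Submodule.exists_fun_fin_finrank_span_eq k (π '' S)
  choose p hpS hpf using hfS
  have hsum : ∀ c : Fin (Module.finrank k (Submodule.span k (π '' S))) → k,
      π (∑ i, C (c i) * p i) = ∑ i, c i • f i := by
    intro c
    rw [map_sum]
    refine Finset.sum_congr rfl fun i _ => ?_
    rw [← smul_eq_C_mul, map_smul, hpf]
  refine ⟨_, p, ?_, hpS, fun c hc => ?_, fun g hg => ?_⟩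
  · exact (Submodule.finrank_mono hle).trans ((finrank_span_finset_le_card _).trans
      (Finset.card_image_le.trans (card_boundedMonomials_le m)))
  · rw [← hπ, hsum] at hc
    exact funext (Fintype.linearIndependent_iff.mp hli c hc)
  · have h1 : π g ∈ Submodule.span k (Set.range f) := by
      rw [hspan, Submodule.span_image]
      exact Submodule.mem_map_of_mem (hS g hg)
    obtain ⟨c, hc⟩ := (Submodule.mem_span_range_iff_exists_fun k).mp h1
    refine ⟨c, ?_⟩
    rw [← hπ, map_sub, hsum, hc, sub_self]

variable {K : Type u} [Field K] [Algebra k K] [FiniteDimensional k K] {i₀ : Fin (N + 1)}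
  {J : Ideal (MvPolynomial (Fin (N + 1)) K)}

/-- In large degree, a basis over `k` of the forms modulo `I` gives generators over `K` of the
space of sections. -/
theorem span_formSection_eq_top (hJ : J = I.map (MvPolynomial.map (algebraMap k K)))
    (hreg : IsRegularCoord I i₀) {m₀ m r : ℕ} (hforms : FormsInDegree I i₀ m₀) (hm : m₀ ≤ m)
    {p : Fin r → MvPolynomial (Fin (N + 1)) k} (hpm : ∀ i, (p i).IsHomogeneous m)
    (hp : ∀ g : MvPolynomial (Fin (N + 1)) k, g.IsHomogeneous m →
      ∃ c : Fin r → k, g - ∑ i, C (c i) * p i ∈ I) :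
    ⊤ ≤ Submodule.span K (Set.range fun i =>
      formSection J (MvPolynomial.map (algebraMap k K) (p i)) ((hpm i).map _)) := by
  intro s _
  have hregJ : IsRegularCoord J i₀ := hJ ▸ hreg.map
  have hformsJ : FormsInDegree J i₀ m₀ := hJ ▸ hforms.map
  obtain ⟨g, hg, hgs⟩ := exists_form_eq hregJ hformsJ 0 (by simpa using hm) s
  let β := Module.finBasis k K
  choose c hc using fun j => hp _ (isHomogeneous_coeffMap (β.coord j) hg)
  rw [Submodule.mem_span_range_iff_exists_fun]
  refine ⟨fun i => ∑ j, β j * algebraMap k K (c j i), ?_⟩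
  rw [eq_comm, ← sub_eq_zero]
  refine eq_zero_of_chart_eq_zero hregJ ?_
  have h1 : (s - ∑ i, (∑ j, β j * algebraMap k K (c j i)) •
      formSection J (MvPolynomial.map (algebraMap k K) (p i)) ((hpm i).map _)).1 i₀ =
      algebraMap (CoordRing J) (Chart J i₀)
        (Ideal.Quotient.mk J (g - ∑ i, C (∑ j, β j * algebraMap k K (c j i)) *
          MvPolynomial.map (algebraMap k K) (p i))) := by
    rw [pow_zero, mul_one] at hgs
    rw [map_sub, map_sub, ← hgs, map_sum, map_sum]
    simp only [AddSubgroupClass.coe_sub, AddSubmonoidClass.coe_finsetSum, Submodule.coe_smul,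
      Pi.sub_apply, Finset.sum_apply, Pi.smul_apply, smul_chart, map_mul]
    rfl
  have h2 : g - ∑ i, C (∑ j, β j * algebraMap k K (c j i)) *
      MvPolynomial.map (algebraMap k K) (p i) = ∑ j, C (β j) * MvPolynomial.map (algebraMap k K)
        (coeffMap (β.coord j) g - ∑ i, C (c j i) * p i) := by
    conv_lhs => rw [eq_sum_coeffMap β g]
    simp only [map_sub, map_sum, map_mul, map_C, mul_sub, Finset.sum_sub_distrib, Finset.mul_sum,
      Finset.sum_mul, mul_assoc]
    rw [Finset.sum_comm]
  have h3 : g - ∑ i, C (∑ j, β j * algebraMap k K (c j i)) *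
      MvPolynomial.map (algebraMap k K) (p i) ∈ J := by
    rw [h2, hJ]
    exact Ideal.sum_mem _ fun j _ => Ideal.mul_mem_left _ _ (Ideal.mem_map_of_mem _ (hc j))
  rw [h1, Ideal.Quotient.eq_zero_iff_mem.mpr h3, map_zero]

end SmallSections

theorem norm_value_formSection_le {k : Type u} [Field k] {K : Type u} [Field K] [Algebra k K]
    {N : ℕ} {J : Ideal (MvPolynomial (Fin (N + 1)) K)}
    {F : Fin (N + 1) → MvPolynomial (Fin (N + 1)) k} {d n E : ℕ}
    {q : MvPolynomial (Fin (N + 1)) k} (hq : q ∈ smallForms F d (d ^ n) E) {C : Type}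
    [NormedField C] {σ : K →+* C} {H : ℝ} (hH : NormGrowth F d (σ.comp (algebraMap k K)) H)
    (x : ConePoint J σ) :
    ‖x.value (d ^ n) (formSection J (MvPolynomial.map (algebraMap k K) q) (hq.1.map _))‖ ≤
      H ^ E * Real.exp ((d : ℝ) ^ n * green (fun i => MvPolynomial.map (algebraMap k K) (F i)) d σ
        x.coords) := by
  rw [value_formSection, eval₂_map, green_map, ← Nat.cast_pow]
  exact hq.2 C _ H hH _ x.ne_zero

/-! ### Explicit constants -/

theorem natCast_le_three_mul_rpow {d : ℕ} (hd : 2 ≤ d) (n : ℕ) :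
    (n : ℝ) ≤ 3 * (d : ℝ) ^ ((n : ℝ) / 2) := by
  have hd' : (2 : ℝ) ≤ d := by exact_mod_cast hd
  have h1 : (d : ℝ) ^ ((n : ℝ) / 2) = √d ^ n := by
    rw [Real.sqrt_eq_rpow, ← Real.rpow_natCast, ← Real.rpow_mul (by positivity)]
    congr 1
    ring
  have h2 : (1 + 1 / 3 : ℝ) ≤ √d := Real.le_sqrt_of_sq_le (by linarith)
  have h3 := one_add_mul_le_pow (by norm_num : (-2 : ℝ) ≤ 1 / 3) n
  rw [h1]
  have := pow_le_pow_left₀ (by norm_num) h2 n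
  linarith

/-- With `ρ = (D (m + 1) ^ M P ^ E exp (2 h)) ⁻¹`, `m = d ^ n`, the logarithm of `(2 ρ) ⁻¹` is
`O(n) + 2 h`. -/
theorem log_bound {d n D M T E : ℕ} (hd : 2 ≤ d) (hn : 1 ≤ n) (hD : 0 < D) (hDn : D ≤ n)
    (hE : E = T * (n + 1)) {P h ρ : ℝ} (hP : 1 ≤ P)
    (hρ : ρ = (D * ((d : ℝ) ^ n + 1) ^ M * (P ^ E * Real.exp (2 * h)))⁻¹) :
    -Real.log (2 * ρ) ≤ (1 + M * (1 + Real.log d) + 2 * T * Real.log P) * n + 2 * h := by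
  have hd' : (2 : ℝ) ≤ d := by exact_mod_cast hd
  have hn' : (1 : ℝ) ≤ n := by exact_mod_cast hn
  have hD' : (0 : ℝ) < D := by exact_mod_cast hD
  have hP0 : 0 < P := by linarith
  have h1 : Real.log ρ =
      -(Real.log D + M * Real.log ((d : ℝ) ^ n + 1) + (E * Real.log P + 2 * h)) := by
    rw [hρ, Real.log_inv, Real.log_mul (by positivity) (by positivity),
      Real.log_mul (by positivity) (by positivity), Real.log_mul (by positivity) (by positivity),
      Real.log_pow, Real.log_pow, Real.log_exp]
  have hρ0 : ρ ≠ 0 := by rw [hρ]; positivity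
  have h2 : Real.log D ≤ n := (Real.log_le_self hD'.le).trans (by exact_mod_cast hDn)
  have h3 : Real.log ((d : ℝ) ^ n + 1) ≤ n * (1 + Real.log d) := by
    have hpow : 1 ≤ (d : ℝ) ^ n := one_le_pow₀ (by linarith)
    refine (Real.log_le_log (by positivity) (by linarith : (d : ℝ) ^ n + 1 ≤ 2 * d ^ n)).trans ?_
    rw [Real.log_mul (by norm_num) (by positivity), Real.log_pow]
    have := Real.log_two_lt_d9
    nlinarith
  have h4 : (E : ℝ) * Real.log P ≤ 2 * T * Real.log P * n := by
    have hE' : (E : ℝ) ≤ 2 * T * n := by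
      rw [hE]
      push_cast
      nlinarith [(Nat.cast_nonneg T : (0 : ℝ) ≤ T)]
    nlinarith [Real.log_nonneg hP]
  have h5 : M * Real.log ((d : ℝ) ^ n + 1) ≤ M * (n * (1 + Real.log d)) :=
    mul_le_mul_of_nonneg_left h3 (Nat.cast_nonneg M)
  rw [Real.log_mul (by norm_num) hρ0, h1]
  have := Real.log_pos (by norm_num : (1 : ℝ) < 2)
  linarith

/-! ### The two ranges of degrees -/

section VolumeBounds

variable {k : Type u} [Field k] [NumberField k] {N : ℕ}
  {I : Ideal (MvPolynomial (Fin (N + 1)) k)} {F : Fin (N + 1) → MvPolynomial (Fin (N + 1)) k}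
  {i₀ : Fin (N + 1)} {d m₀ B T : ℕ} {A : ℝ}

theorem height_term_nonneg {K : Type*} [Field K] [NumberField K] (d n : ℕ) (α : K) :
    0 ≤ (d : ℝ) ^ ((n : ℝ) / 2) +
      (Module.finrank ℚ K : ℝ) ^ 2 * (Height.logHeight₁ α / Module.finrank ℚ K) := by
  have := Height.zero_le_logHeight₁ α
  positivity

theorem VolumeBound.mono {n : ℕ} {α : k} {c c' : ℝ} (h : VolumeBound I F d n α c) (hc : c ≤ c') :
    VolumeBound I F d n α c' := by
  refine ⟨h.1, fun E => ?_⟩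
  obtain ⟨h1, h2, h3, h4, h5⟩ := h.2 E
  refine ⟨h1, h2, h3, h4, le_trans ?_ h5⟩
  have := mul_le_mul_of_nonneg_right hc (height_term_nonneg d n α)
  linarith

/-- The constant that is valid in large degree, for all extensions of `k`. -/
noncomputable def largeDegreeConst (N d T B : ℕ) (A : ℝ) : ℝ :=
  3 * (1 + (N + 1 : ℕ) * (1 + Real.log d) + 2 * T * Real.log (B * A)) + 2

theorem largeDegreeConst_pos (hB : 0 < B) (hA : 1 ≤ A) :
    0 < largeDegreeConst N d T B A := by
  have h1 : 0 ≤ Real.log d := Real.log_natCast_nonneg d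
  have h2 : 0 ≤ Real.log (B * A) :=
    Real.log_nonneg (one_le_mul_of_one_le_of_one_le (by exact_mod_cast hB) hA)
  rw [largeDegreeConst]
  positivity

/-- In large degree the bound holds with a constant that does not depend on `K`: the basis of
sections is defined over `k` and has norms `exp (O(n))`. -/
theorem volumeBound_of_le [I.IsPrime] (hi₀ : X i₀ ∉ I) (hreg : IsRegularCoord I i₀)
    (hforms : FormsInDegree I i₀ m₀) (hd : 2 ≤ d)
    (hA : ∀ σ : k →+* ℂ, NormGrowth F d σ A) (hB : 0 < B)
    (hB' : ∀ (p : ℕ) [Fact p.Prime] (σ : k →+* ℂ_[p]), NormGrowth F d σ ‖(B : ℂ_[p])‖⁻¹)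
    (hT : ∀ n m, m ≤ d ^ n → ∀ q : MvPolynomial (Fin (N + 1)) k, q.IsHomogeneous m →
      q ∈ Submodule.span k (smallForms F d m (T * (n + 1))))
    {K : Type u} [Field K] [NumberField K] [Algebra k K]
    {J : Ideal (MvPolynomial (Fin (N + 1)) K)}
    (hJ : J = I.map (MvPolynomial.map (algebraMap k K)))
    {F' : Fin (N + 1) → MvPolynomial (Fin (N + 1)) K}
    (hF' : F' = fun i => MvPolynomial.map (algebraMap k K) (F i)) {n : ℕ}
    (hm₀ : m₀ ≤ n) (hn : Module.finrank ℚ K ≤ n) {α : K}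
    (hα : IntermediateField.adjoin ℚ {α} = ⊤) :
    VolumeBound J F' d n α (largeDegreeConst N d T B A) := by
  have : FiniteDimensional k K := FiniteDimensional.right ℚ k K
  have hD : 0 < Module.finrank ℚ K := Module.finrank_pos
  obtain ⟨σ₀⟩ : Nonempty (k →+* ℂ) := inferInstance
  have hA1 : 1 ≤ A := (hA σ₀).one_le
  have hB1 : (1 : ℝ) ≤ B := by exact_mod_cast hB
  have hBA : 1 ≤ B * A := one_le_mul_of_one_le_of_one_le hB1 hA1
  have hmn : m₀ ≤ d ^ n := hm₀.trans (Nat.lt_pow_self (by omega)).le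
  set E := T * (n + 1) with hE
  obtain ⟨r, p, hr, hpS, hpI, hpg⟩ :=
    exists_forms_basis (I := I) (fun q hq => hq.1) (hT n (d ^ n) le_rfl)
  obtain ⟨w₀, hw₀, hw₀'⟩ := exists_integral_basis_norm_le hα
  set h := Module.finrank ℚ K * Height.logHeight₁ α with hh
  have hBQ : ((B : ℚ) ^ E) ≠ 0 := pow_ne_zero _ (by exact_mod_cast hB.ne')
  -- The factor `B ^ E` compensates the non-archimedean norms `|B| ^ (-E)` of the forms `p i`.
  let w := w₀.unitsSMul fun _ => Units.mk0 ((B : ℚ) ^ E) hBQ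
  have hw : ∀ j, w j = (B : K) ^ E * w₀ j := by
    intro j
    rw [Module.Basis.unitsSMul_apply, Units.smul_def, Units.val_mk0, Algebra.smul_def]
    simp
  let ρ : ℝ := ((Module.finrank ℚ K : ℝ) * ((d : ℝ) ^ n + 1) ^ (N + 1) *
    ((B * A) ^ E * Real.exp (2 * h)))⁻¹
  have hh0 : 0 ≤ h := mul_nonneg (Nat.cast_nonneg _) (Height.zero_le_logHeight₁ α)
  have hlog : -Real.log (2 * ρ) ≤ largeDegreeConst N d T B A * ((d : ℝ) ^ ((n : ℝ) / 2) +
      (Module.finrank ℚ K : ℝ) ^ 2 * (Height.logHeight₁ α / Module.finrank ℚ K)) := by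
    have h1 := log_bound (M := N + 1) (T := T) hd (hD.trans_le hn) hD hn hE hBA (h := h) rfl
    have h2 : (Module.finrank ℚ K : ℝ) ^ 2 * (Height.logHeight₁ α / Module.finrank ℚ K) = h := by
      rw [hh]
      field_simp
    have h3 := natCast_le_three_mul_rpow hd n
    have h4 : 0 ≤ 1 + ((N + 1 : ℕ) : ℝ) * (1 + Real.log d) + 2 * T * Real.log (B * A) := by
      have := Real.log_natCast_nonneg d
      have := Real.log_nonneg hBA
      positivity
    rw [h2, largeDegreeConst]
    have h5 : 0 ≤ (d : ℝ) ^ ((n : ℝ) / 2) := by positivity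
    have h6 := mul_le_mul_of_nonneg_left h3 h4
    have h7 := mul_nonneg h4 hh0
    refine h1.trans ?_
    nlinarith
  refine volumeBound_of_basis (e := 0) hi₀ hd hJ hB hB' hpI
    (span_formSection_eq_top hJ hreg hforms hmn (fun i => (hpS i).1) hpg)
    (fun i => by rw [pow_zero, mul_one]; rfl) hF' w ?_ (ρ := ρ) (by positivity)
    (T := (B * A) ^ E * Real.exp (2 * h)) ?_ ?_
    (mul_nonneg (largeDegreeConst_pos hB hA1).le (height_term_nonneg d n α)) hlog
  · intro q _ σ x j i
    have h1 := norm_value_formSection_le (hpS i) (hB' q _) x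
    have hB0 : (0 : ℝ) < ‖(B : ℂ_[q])‖ := norm_pos_iff.mpr (by exact_mod_cast hB.ne')
    rw [← hF'] at h1
    rw [hw, map_mul, map_pow, map_natCast, norm_mul, norm_pow, mul_assoc]
    calc ‖(B : ℂ_[q])‖ ^ E * (‖σ (w₀ j)‖ * _)
        ≤ ‖(B : ℂ_[q])‖ ^ E * (1 * (‖(B : ℂ_[q])‖⁻¹ ^ E *
          Real.exp ((d : ℝ) ^ n * green F' d σ x.coords))) := by
          gcongr
          exact norm_le_one_of_isIntegral σ (hw₀ j)
      _ = Real.exp ((d : ℝ) ^ n * green F' d σ x.coords) := by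
          rw [one_mul, ← mul_assoc, ← mul_pow, mul_inv_cancel₀ hB0.ne', one_pow, one_mul]
  · intro σ x j i
    have h1 := norm_value_formSection_le (hpS i) (hA _) x
    rw [← hF'] at h1
    rw [hw, map_mul, map_pow, map_natCast, norm_mul, norm_pow, Complex.norm_natCast, mul_assoc]
    calc (B : ℝ) ^ E * (‖σ (w₀ j)‖ * _)
        ≤ (B : ℝ) ^ E * (Real.exp (2 * h) * (A ^ E *
          Real.exp ((d : ℝ) ^ n * green F' d σ x.coords))) := by
          gcongr
          rw [hh, ← mul_assoc]
          exact hw₀' j σ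
      _ = _ := by rw [mul_pow]; ring
  · have hr' : (r : ℝ) ≤ ((d : ℝ) ^ n + 1) ^ (N + 1) := by
      have : (r : ℝ) ≤ (((d ^ n + 1) ^ (N + 1) : ℕ) : ℝ) := by exact_mod_cast hr
      simpa using this
    have hD' : (0 : ℝ) < Module.finrank ℚ K := by exact_mod_cast hD
    have hP : 0 < (B * A) ^ E * Real.exp (2 * h) := by positivity
    calc (Module.finrank ℚ K : ℝ) * r * (ρ * ((B * A) ^ E * Real.exp (2 * h)))
        ≤ (Module.finrank ℚ K : ℝ) * ((d : ℝ) ^ n + 1) ^ (N + 1) *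
          (ρ * ((B * A) ^ E * Real.exp (2 * h))) := by gcongr
      _ = 1 := by
          simp only [ρ]
          field_simp

/-- Over `k` the bound holds in each degree, with a constant that may depend on the degree. -/
theorem exists_volumeBound [I.IsPrime] (hi₀ : X i₀ ∉ I) (hreg : IsRegularCoord I i₀)
    (hforms : FormsInDegree I i₀ m₀) (hd : 2 ≤ d)
    (hA : ∀ σ : k →+* ℂ, NormGrowth F d σ A) (hB : 0 < B)
    (hB' : ∀ (p : ℕ) [Fact p.Prime] (σ : k →+* ℂ_[p]), NormGrowth F d σ ‖(B : ℂ_[p])‖⁻¹)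
    (n : ℕ) : ∃ c : ℝ, 0 < c ∧ ∀ α : k, VolumeBound I F d n α c := by
  have := finite_globalSections hreg hforms (d ^ n)
  let b := Module.finBasis k (GlobalSections I (d ^ n))
  set r := Module.finrank k (GlobalSections I (d ^ n))
  choose p hpm hpb using fun i => exists_form_eq hreg hforms m₀ (by omega) (b i)
  have hpI : ∀ c : Fin r → k, ∑ i, C (c i) * p i ∈ I → c = 0 := by
    intro c hc
    have h1 : ∑ i, c i • b i = 0 := by
      refine eq_zero_of_chart_eq_zero hreg (((isUnit_coordElt I i₀).pow m₀).mul_left_eq_zero.mp ?_)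
      have h2 : (∑ i, c i • b i).1 i₀ * algebraMap (CoordRing I) (Chart I i₀)
          (coordElt I i₀) ^ m₀ = algebraMap (CoordRing I) (Chart I i₀)
            (Ideal.Quotient.mk I (∑ i, C (c i) * p i)) := by
        rw [map_sum, map_sum]
        simp only [map_mul, ← hpb, AddSubmonoidClass.coe_finsetSum, Submodule.coe_smul,
          Finset.sum_apply, Pi.smul_apply, smul_chart, Finset.sum_mul, mul_assoc]
      rw [h2, Ideal.Quotient.eq_zero_iff_mem.mpr hc, map_zero]
    exact funext (Fintype.linearIndependent_iff.mp b.linearIndependent c h1)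
  choose a ha1 ha using fun i => exists_norm_value_le_complex (b i)
  choose β hβ0 hβ using fun i => exists_norm_value_le_padic (b i)
  obtain ⟨σ₀⟩ : Nonempty (k →+* ℂ) := inferInstance
  have hA1 : 1 ≤ A := (hA σ₀).one_le
  let Q : ℕ := (∏ i, β i) * B ^ d ^ n
  have hβ0' : 0 < ∏ i, β i := Finset.prod_pos fun i _ => hβ0 i
  have hQ : 0 < Q := Nat.mul_pos hβ0' (pow_pos hB _)
  have hQQ : (Q : ℚ) ≠ 0 := by exact_mod_cast hQ.ne'
  let w₀ := NumberField.integralBasis k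
  let w := w₀.unitsSMul fun _ => Units.mk0 (Q : ℚ) hQQ
  have hw : ∀ j, w j = (Q : k) * w₀ j := by
    intro j
    rw [Module.Basis.unitsSMul_apply, Units.smul_def, Units.val_mk0, Algebra.smul_def]
    simp
  let W : ℝ := ∑ j, ∑ σ : k →+* ℂ, ‖σ (w j)‖
  have hW : ∀ j (σ : k →+* ℂ), ‖σ (w j)‖ ≤ W := fun j σ =>
    (Finset.single_le_sum (f := fun σ : k →+* ℂ => ‖σ (w j)‖) (fun _ _ => norm_nonneg _)
      (Finset.mem_univ σ)).trans (Finset.single_le_sum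
        (f := fun j => ∑ σ : k →+* ℂ, ‖σ (w j)‖) (fun _ _ => by positivity) (Finset.mem_univ j))
  have hW0 : 0 ≤ W := by positivity
  let a₀ : ℝ := ∑ i, a i
  have ha₀ : ∀ i, a i ≤ a₀ := fun i => Finset.single_le_sum (f := a)
    (fun i _ => zero_le_one.trans (ha1 i)) (Finset.mem_univ i)
  have ha₀0 : 0 ≤ a₀ := Finset.sum_nonneg fun i _ => zero_le_one.trans (ha1 i)
  let T₀ : ℝ := W * (a₀ * A ^ d ^ n)
  have hT₀ : 0 ≤ T₀ := by positivity
  -- The summand `1` keeps `ρ` positive when there are no sections.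
  let ρ : ℝ := (Module.finrank ℚ k * r * T₀ + 1)⁻¹
  have hρ : 0 < ρ := by positivity
  have hexp : ∀ t : ℝ, Real.exp t ^ d ^ n = Real.exp ((d : ℝ) ^ n * t) := fun t => by
    rw [← Real.exp_nat_mul, Nat.cast_pow]
  have hmap : MvPolynomial.map (σ := Fin (N + 1)) (algebraMap k k) = RingHom.id _ :=
    RingHom.ext fun q => MvPolynomial.map_id q
  refine ⟨|Real.log (2 * ρ)| + 1, by positivity, fun α => ?_⟩
  refine volumeBound_of_basis (e := m₀) (p := p) (b := b) hi₀ hd (K := k)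
    (by rw [hmap, Ideal.map_id]) hB hB' hpI b.span_eq.ge (fun i => ?_) (by rw [hmap]; rfl) w ?_ hρ
    (T := T₀) ?_ ?_ (mul_nonneg (by positivity) (height_term_nonneg d n α)) ?_
  · rw [hmap]
    exact hpb i
  · intro q _ σ x j i
    have hB0 : (0 : ℝ) < ‖(B : ℂ_[q])‖ := norm_pos_iff.mpr (by exact_mod_cast hB.ne')
    have hβi : (0 : ℝ) < ‖(β i : ℂ_[q])‖ := norm_pos_iff.mpr (by exact_mod_cast (hβ0 i).ne')
    have hprod : ‖((∏ i, β i : ℕ) : ℂ_[q])‖ ≤ ‖(β i : ℂ_[q])‖ := by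
      obtain ⟨c, hc⟩ := Finset.dvd_prod_of_mem β (Finset.mem_univ i)
      rw [hc, Nat.cast_mul, norm_mul]
      refine mul_le_of_le_one_right (norm_nonneg _) ?_
      exact_mod_cast IsUltrametricDist.norm_intCast_le_one ℂ_[q] c
    have hQn : ‖(Q : ℂ_[q])‖ = ‖((∏ i, β i : ℕ) : ℂ_[q])‖ * ‖(B : ℂ_[q])‖ ^ d ^ n := by
      rw [← norm_pow, ← norm_mul]
      simp only [Q, Nat.cast_mul, Nat.cast_pow]
    rw [hw, map_mul, map_natCast, norm_mul, hQn]
    calc ‖((∏ i, β i : ℕ) : ℂ_[q])‖ * ‖(B : ℂ_[q])‖ ^ d ^ n * ‖σ (w₀ j)‖ * ‖x.value (d ^ n) (b i)‖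
        ≤ ‖(β i : ℂ_[q])‖ * ‖(B : ℂ_[q])‖ ^ d ^ n * 1 * (‖(β i : ℂ_[q])‖⁻¹ *
          (‖(B : ℂ_[q])‖⁻¹ * Real.exp (green F d σ x.coords)) ^ d ^ n) := by
          gcongr
          · refine norm_le_one_of_isIntegral σ ?_
            rw [NumberField.integralBasis_apply]
            exact NumberField.RingOfIntegers.isIntegral_coe _
          · refine (hβ i q σ x).trans ?_
            gcongr
            exact (hB' q σ).norm_le hd x.ne_zero
      _ = _ := by
          rw [← hexp, mul_pow, inv_pow]
          field_simp
  · intro σ x j i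
    calc ‖σ (w j)‖ * ‖x.value (d ^ n) (b i)‖
        ≤ W * (a₀ * (A * Real.exp (green F d σ x.coords)) ^ d ^ n) := by
          gcongr
          · exact hW j σ
          · refine (ha i σ x).trans ?_
            gcongr
            · exact ha₀ i
            · exact (hA σ).norm_le hd x.ne_zero
      _ = _ := by
          rw [mul_pow, hexp]
          ring
  · have h1 : (0 : ℝ) < Module.finrank ℚ k * r * T₀ + 1 := by positivity
    rw [mul_left_comm, ← div_eq_inv_mul, div_le_one h1]
    linarith
  · have h1 : 1 ≤ (d : ℝ) ^ ((n : ℝ) / 2) :=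
      Real.one_le_rpow (by exact_mod_cast (by omega : 1 ≤ d)) (by positivity)
    have h2 : 0 ≤ (Module.finrank ℚ k : ℝ) ^ 2 * (Height.logHeight₁ α / Module.finrank ℚ k) := by
      have := Height.zero_le_logHeight₁ α
      positivity
    have h3 := neg_abs_le (Real.log (2 * ρ))
    have h4 := abs_nonneg (Real.log (2 * ρ))
    nlinarith

end VolumeBounds

end PolarizedVolume

/-! ### The uniform bound -/

theorem theorem5p1 {k : Type u} [Field k] [NumberField k] (N d : ℕ) (hd : 2 ≤ d)
    (I : Ideal (MvPolynomial (Fin (N + 1)) k))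
    (hI : ∀ p ∈ I, ∀ m : ℕ, MvPolynomial.homogeneousComponent m p ∈ I)
    (hprime : I.IsPrime)
    (hnonempty : ∃ i, (MvPolynomial.X i : MvPolynomial (Fin (N + 1)) k) ∉ I)
    (F : Fin (N + 1) → MvPolynomial (Fin (N + 1)) k)
    (hF : ∀ i, (F i).IsHomogeneous d)
    (hFzero : ∀ x : Fin (N + 1) → AlgebraicClosure k,
      (∀ i, MvPolynomial.aeval x (F i) = 0) → x = 0)
    (hFX : ∀ p ∈ I, MvPolynomial.bind₁ F p ∈ I) :
    ∃ c : ℝ, 0 < c ∧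
      (∀ n : ℕ, 0 < n → ∀ α : k, IntermediateField.adjoin ℚ {α} = ⊤ →
        PolarizedVolume.VolumeBound I F d n α c) ∧
      ∀ D : ℕ, ∃ n₀ : ℕ, ∀ (K : Type u) [Field K] [NumberField K] [Algebra k K],
        Module.finrank ℚ K = D → ∀ n : ℕ, n₀ ≤ n →
        ∀ α : K, IntermediateField.adjoin ℚ {α} = ⊤ →
          PolarizedVolume.VolumeBound (I.map (MvPolynomial.map (algebraMap k K)))
            (fun i => MvPolynomial.map (algebraMap k K) (F i)) d n α c := by
  open PolarizedVolume in
  obtain ⟨i₀, hi₀⟩ := hnonempty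
  have hreg : IsRegularCoord I i₀ := fun f hf => (hprime.mem_or_mem hf).resolve_right hi₀
  obtain ⟨m₀, hforms⟩ := exists_forall_fraction_eq_form hI hi₀
  obtain ⟨⟨A, hA⟩, B, hB, hB'⟩ := exists_uniform_normGrowth (by omega : 1 ≤ d) hF hFzero
  obtain ⟨T, hT⟩ := exists_mem_span_smallForms hd hF hFzero
  obtain ⟨σ₀⟩ : Nonempty (k →+* ℂ) := inferInstance
  have hc₁ := largeDegreeConst_pos (N := N) (d := d) (T := T) hB (hA σ₀).one_le
  choose c hc0 hc using exists_volumeBound hi₀ hreg hforms hd hA hB hB'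
  set c₁ := largeDegreeConst N d T B A
  -- Over `k` only finitely many degrees are not covered by the uniform constant.
  set n₁ := max m₀ (Module.finrank ℚ k)
  have hsum : 0 ≤ ∑ n ∈ Finset.range n₁, c n := Finset.sum_nonneg fun n _ => (hc0 n).le
  refine ⟨c₁ + ∑ n ∈ Finset.range n₁, c n, by linarith, fun n _ α hα => ?_, fun D =>
    ⟨max m₀ D, fun K _ _ _ hD n hn α hα => ?_⟩⟩
  · rcases lt_or_ge n n₁ with hn | hn
    · refine (hc n α).mono ?_
      have := Finset.single_le_sum (f := c) (fun n _ => (hc0 n).le) (Finset.mem_range.mpr hn)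
      linarith
    · have hmap : MvPolynomial.map (σ := Fin (N + 1)) (algebraMap k k) = RingHom.id _ :=
        RingHom.ext fun q => MvPolynomial.map_id q
      refine (volumeBound_of_le hi₀ hreg hforms hd hA hB hB' hT (K := k)
        (by rw [hmap, Ideal.map_id]) (by rw [hmap]; rfl) ((le_max_left _ _).trans hn)
        ((le_max_right _ _).trans hn) hα).mono ?_
      linarith
  · refine (volumeBound_of_le hi₀ hreg hforms hd hA hB hB' hT rfl rfl
      ((le_max_left _ _).trans hn) (hD ▸ (le_max_right _ _).trans hn) hα).mono ?_
    linarith
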